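/- Let $I\subseteq\mathbb R$ be an open interval and let $k,f,g\colon I\to\mathbb R$ be smooth functions with $f(t)g(t)\neq0$ for all $t\in I$. Consider the Gardner equation $$u_t+k(t)uu_x+f(t)u^2u_x+g(t)u_{xxx}=0,\qquad t\in I. \tag{1}$$ Let $D\subseteq I\times\mathbb R\times\mathbb R$ be any open set of points $(t,x,u)$ whose projection to the $t$-axis is all of $I$ (for example $D=I\times\mathbb R\times\mathbb R$). Call (1) reducible to constant coefficients on $D$ if there are constants $\tilde k,\tilde f,\tilde g\in\mathbb R$ with $\tilde f\tilde g\ne0$ and a point transformation $(t,x,u)\mapsto(\tilde t,\tilde x,\tilde u)$, that is, a smooth diffeomorphism from $D$ onto an open subset of $\mathbb R^3$, that maps equation (1) to the equation $$\tilde u_{\tilde t}+\tilde k\tilde u\tilde u_{\tilde x}+\tilde f\tilde u^2\tilde u_{\tilde x}+\tilde g\tilde u_{\tilde x\tilde x\tilde x}=0;$$ here "maps" means that, whenever the transformation takes the graph of a smooth function $u$ near a point $(t,x)$ into the graph of a smooth function $\tilde u$, the function $u$ satisfies the first equation at $(t,x)$ if and only if $\tilde u$ satisfies the second one at the corresponding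 point $(\tilde t,\tilde x)$ (equivalently, the prolongation of the transformation to third-order jets maps one equation to the other). If $k$ vanishes nowhere on $I$, then (1) is reducible to constant coefficients on $D$ if and only if $$\left(\frac fk\right)_t=\left(\frac gk\right)_t=0\quad\text{on } I.$$ If $k$ vanishes at some point of $I$, then (1) is reducible to constant coefficients on $D$ if and only if $k$ vanishes identically on $I$ and $(g/f)_t=0$ on $I$. -/

import Mathlib

open scoped ContDiff Topology

/-- The triple `(k, f, g)` of coefficients defines, for `t ∈ I`, an equation
`u_t + k(t) u u_x + f(t) u ^ 2 u_x + g(t) u_xxx = 0` of the class of Gardner equations: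
`k`, `f`, `g` are smooth on `I`, and `f g` does not vanish on `I`. -/
structure IsGardnerOn (I : Set ℝ) (k f g : ℝ → ℝ) : Prop where
  smooth_k : ContDiffOn ℝ ∞ k I
  smooth_f : ContDiffOn ℝ ∞ f I
  smooth_g : ContDiffOn ℝ ∞ g I
  fg_ne_zero : ∀ t ∈ I, f t * g t ≠ 0

/-- The function `u` of `(t, x)` satisfies the Gardner equation with coefficients `k`, `f`, `g`
at the point `p = (t, x)`: a condition on the third-order jet of `u` at `p` only. -/
def GardnerAt (k f g : ℝ → ℝ) (u : ℝ × ℝ → ℝ) (p : ℝ × ℝ) : Prop :=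
  deriv (fun s : ℝ => u (s, p.2)) p.1
    + k p.1 * u p * deriv (fun y : ℝ => u (p.1, y)) p.2
    + f p.1 * u p ^ 2 * deriv (fun y : ℝ => u (p.1, y)) p.2
    + g p.1 * iteratedDeriv 3 (fun y : ℝ => u (p.1, y)) p.2 = 0

/-- A nondegenerate point transformation `(t, x, u) ↦ (t', x', u')`: a smooth diffeomorphism
from the open set `Φ.source` onto the open set `Φ.target`. -/
structure IsPointTransformation
    (Φ : OpenPartialHomeomorph (ℝ × ℝ × ℝ) (ℝ × ℝ × ℝ)) : Prop where
  smooth : ContDiffOn ℝ ∞ Φ Φ.source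
  smooth_symm : ContDiffOn ℝ ∞ Φ.symm Φ.target

/-- The point of the graph of `u` over `p = (t, x)`. -/
def graphPoint (u : ℝ × ℝ → ℝ) (p : ℝ × ℝ) : ℝ × ℝ × ℝ := (p.1, p.2, u p)

/-- The projection `(t, x, u) ↦ (t, x)`. -/
def basePoint (z : ℝ × ℝ × ℝ) : ℝ × ℝ := (z.1, z.2.1)

/-- `Φ` maps the germ at `p` of the graph of the smooth function `u` to a germ of the graph of
the smooth function `w`. As `Φ` is a diffeomorphism, `q ↦ basePoint (Φ (graphPoint u q))` is
then a local diffeomorphism at `p`, and the jet of `w` at the image of `p` is the image of the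
jet of `u` at `p` under the prolongation of `Φ`. -/
structure TransformsAt (Φ : OpenPartialHomeomorph (ℝ × ℝ × ℝ) (ℝ × ℝ × ℝ))
    (u w : ℝ × ℝ → ℝ) (p : ℝ × ℝ) : Prop where
  mem_source : graphPoint u p ∈ Φ.source
  smooth_left : ContDiffAt ℝ ∞ u p
  smooth_right : ContDiffAt ℝ ∞ w (basePoint (Φ (graphPoint u p)))
  graph : ∀ᶠ q in 𝓝 p, Φ (graphPoint u q) = graphPoint w (basePoint (Φ (graphPoint u q)))

/-- The point transformation `Φ` maps the Gardner equation with coefficients `k`, `f`, `g` to the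
one with coefficients `k'`, `f'`, `g'`: the prolongation of `Φ` to third-order jets maps the
submanifold defined by the first equation to the one defined by the second. The jets are
represented by germs of arbitrary smooth functions, which need not be solutions. -/
def MapsGardner (Φ : OpenPartialHomeomorph (ℝ × ℝ × ℝ) (ℝ × ℝ × ℝ))
    (k f g k' f' g' : ℝ → ℝ) : Prop :=
  ∀ (u w : ℝ × ℝ → ℝ) (p : ℝ × ℝ), TransformsAt Φ u w p →
    (GardnerAt k f g u p ↔ GardnerAt k' f' g' w (basePoint (Φ (graphPoint u p))))

/-- The Gardner equation with coefficients `k`, `f`, `g` is mapped by some point transformation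
with domain `D` to an equation of the class whose coefficients are constants. -/
def ReducibleToConstant (D : Set (ℝ × ℝ × ℝ)) (k f g : ℝ → ℝ) : Prop :=
  ∃ Φ : OpenPartialHomeomorph (ℝ × ℝ × ℝ) (ℝ × ℝ × ℝ),
    IsPointTransformation Φ ∧ Φ.source = D ∧
    ∃ k' f' g' : ℝ, IsGardnerOn Set.univ (fun _ => k') (fun _ => f') (fun _ => g') ∧
      MapsGardner Φ k f g (fun _ => k') (fun _ => f') (fun _ => g')

/-! Both cases of the theorem follow from `reducibleToConstant_iff_proportional`: reducibility means
that $k=cf$ and $g=df$ on $I$ with constants $c,d$. If so, a new time $S(t)$ with $S'=f$ divides the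
equation by $f$ and makes the coefficients constant (`reducible_of_proportional`).

For the converse, let $(T,X,U)$ be the components of the transformation. The hypothesis compares
jets of arbitrary functions, so it can be tested on a function $u$ that satisfies (1) at a point and
on a perturbation $u+h$. A perturbation that cannot be seen by the target equation at the image
point must not be seen by (1) either. With $h=(T-T_0)^3$ along the graph, the transformed functions
agree where $T=T_0$, and (1) forces $D_xT=0$; varying the slope gives $T_x=T_u=0$
(`MapsGardner.pdX_pdU_eq_zero`). With $h=-6\tilde g(T-T_0)+(X-X_0)^3$, the changes of $\tilde
u_{\tilde t}$ and $\tilde g\tilde u_{\tilde x\tilde x\tilde x}$ cancel, and (1) forces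
$g(D_xX)^3=\tilde gT_t$. Hence $X_u=0$, and then $X_{xx}=0$.

The third-order chain rule is now short, and the equation splits into powers of the free derivatives
$a=u_x$ and $b=u_{xx}$ (`MapsGardner.determining_eq`). The split system yields
$U_{uu}=U_x=U_t=X_{tx}=0$ together with relations expressing $k/f$ and $g/f$ through $U$, $U_u$,
$X_x$ and constants (`MapsGardner.normal_form`). None of these depends on $t$, so both ratios have
zero derivative, hence are constant on the interval. -/

open Set Filter

/-! ### Sufficiency: changing the time variable -/

theorem exists_antideriv_on {I : Set ℝ} (hI : IsOpen I) (hI' : I.OrdConnected) {f : ℝ → ℝ}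
    (hf : ContinuousOn f I) : ∃ T : ℝ → ℝ, ∀ t ∈ I, HasDerivAt T (f t) t := by
  rcases I.eq_empty_or_nonempty with rfl | ⟨t₀, ht₀⟩
  · exact ⟨0, by simp⟩
  refine ⟨fun t => ∫ s in t₀..t, f s, fun t ht => ?_⟩
  have hsub : uIcc t₀ t ⊆ I := hI'.uIcc_subset ht₀ ht
  refine intervalIntegral.integral_hasDerivAt_right (hf.mono hsub).intervalIntegrable ?_
    (hf.continuousAt (hI.mem_nhds ht))
  exact hf.stronglyMeasurableAtFilter hI t ht

theorem injOn_of_hasDerivAt_ne_zero {I : Set ℝ} (hI' : I.OrdConnected) {T f : ℝ → ℝ}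
    (hT : ∀ t ∈ I, HasDerivAt T (f t) t) (hf : ∀ t ∈ I, f t ≠ 0) : InjOn T I := by
  have key : ∀ a ∈ I, ∀ b ∈ I, a < b → T a ≠ T b := by
    intro a ha b hb hab h
    have hsub : Icc a b ⊆ I := hI'.out ha hb
    obtain ⟨c, hc, hc0⟩ := exists_hasDerivAt_eq_zero hab
      (fun x hx => (hT x (hsub hx)).continuousAt.continuousWithinAt) h
      (fun x hx => hT x (hsub (Ioo_subset_Icc_self hx)))
    exact hf c (hsub (Ioo_subset_Icc_self hc)) hc0
  intro a ha b hb h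
  rcases lt_trichotomy a b with h1 | h1 | h1
  · exact absurd h (key a ha b hb h1)
  · exact h1
  · exact absurd h.symm (key b hb a ha h1)

/-- A nowhere vanishing smooth function on an open interval is the derivative of a smooth
diffeomorphism of the interval onto an open set. -/
theorem exists_diffeo_with_deriv {I : Set ℝ} (hI : IsOpen I) (hI' : I.OrdConnected)
    {f : ℝ → ℝ} (hf : ContDiffOn ℝ ∞ f I) (hf0 : ∀ t ∈ I, f t ≠ 0) :
    ∃ S : OpenPartialHomeomorph ℝ ℝ, S.source = I ∧ ContDiffOn ℝ ∞ S I ∧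
      ContDiffOn ℝ ∞ S.symm S.target ∧ ∀ t ∈ I, HasDerivAt S (f t) t := by
  obtain ⟨T, hT⟩ := exists_antideriv_on hI hI' hf.continuousOn
  have hTs : ContDiffOn ℝ ∞ T I := by
    rw [contDiffOn_infty_iff_deriv_of_isOpen hI]
    exact ⟨fun t ht => (hT t ht).differentiableAt.differentiableWithinAt,
      hf.congr fun t ht => (hT t ht).deriv⟩
  have hinj := injOn_of_hasDerivAt_ne_zero hI' hT hf0
  -- Openness is local: the inverse function theorem applies at each point because the derivative `f
  -- t` is nonzero.
  have hopen : IsOpenMap (I.domRestrict T) := by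
    rw [isOpenMap_iff_nhds_le]
    rintro ⟨t, ht⟩
    have h1 : HasStrictDerivAt T (f t) t :=
      (hTs.contDiffAt (hI.mem_nhds ht)).hasStrictDerivAt' (hT t ht) (by simp)
    have h2 := h1.map_nhds_eq (hf0 t ht)
    have h3 : map (I.domRestrict T) (𝓝 ⟨t, ht⟩) = map T (𝓝 t) := by
      rw [show I.domRestrict T = T ∘ Subtype.val from rfl, ← map_map,
        map_nhds_subtype_coe_eq_nhds ht (hI.mem_nhds ht)]
    rw [h3, h2]
    exact le_rfl
  let S : OpenPartialHomeomorph ℝ ℝ := OpenPartialHomeomorph.ofContinuousOpenRestrict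
    (hinj.toPartialEquiv T I) hTs.continuousOn hopen hI
  have hS : (S : ℝ → ℝ) = T := rfl
  refine ⟨S, rfl, hTs, fun y hy => ?_, hT⟩
  have hy' : S.symm y ∈ I := S.map_target hy
  exact (S.contDiffAt_symm_deriv (hf0 _ hy') hy (hT _ hy')
    (hTs.contDiffAt (hI.mem_nhds hy'))).contDiffWithinAt

/-- A change of the time variable as a point transformation. -/
theorem exists_time_change {I : Set ℝ} {S : OpenPartialHomeomorph ℝ ℝ} (hS : S.source = I)
    (h1 : ContDiffOn ℝ ∞ S I) (h2 : ContDiffOn ℝ ∞ S.symm S.target)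
    {D : Set (ℝ × ℝ × ℝ)} (hD : IsOpen D) (hDI : ∀ z ∈ D, z.1 ∈ I) :
    ∃ Φ : OpenPartialHomeomorph (ℝ × ℝ × ℝ) (ℝ × ℝ × ℝ), IsPointTransformation Φ ∧
      Φ.source = D ∧ ∀ z, Φ z = (S z.1, z.2) := by
  let Ψ := S.prod (OpenPartialHomeomorph.refl (ℝ × ℝ))
  have hsrc : Ψ.source = I ×ˢ univ := by simp [Ψ, hS]
  have hΦ : (Ψ.restrOpen D hD).source = D := by
    rw [OpenPartialHomeomorph.restrOpen_source, hsrc]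
    exact inter_eq_right.2 fun z hz => ⟨hDI z hz, mem_univ _⟩
  refine ⟨Ψ.restrOpen D hD, ⟨?_, ?_⟩, hΦ, fun z => rfl⟩
  · rw [hΦ]
    change ContDiffOn ℝ ∞ (fun z : ℝ × ℝ × ℝ => (S z.1, z.2)) D
    exact (h1.comp contDiff_fst.contDiffOn hDI).prodMk contDiff_snd.contDiffOn
  · change ContDiffOn ℝ ∞ (fun z : ℝ × ℝ × ℝ => (S.symm z.1, z.2)) _
    refine (h2.comp contDiff_fst.contDiffOn ?_).prodMk contDiff_snd.contDiffOn
    rintro z ⟨hz, -⟩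
    simpa [Ψ] using hz

theorem hasDerivAt_time_change {w : ℝ × ℝ → ℝ} {S : ℝ → ℝ} {t x s : ℝ}
    (hw : ContDiffAt ℝ ∞ w (S t, x)) (hS : HasDerivAt S s t) :
    HasDerivAt (fun r => w (S r, x)) (deriv (fun r => w (r, x)) (S t) * s) t := by
  have h : DifferentiableAt ℝ (fun r => w (r, x)) (S t) := by
    have h0 : DifferentiableAt ℝ w (S t, x) := hw.differentiableAt (by simp)
    exact DifferentiableAt.comp (f := fun r : ℝ => (r, x)) (S t) h0 (by fun_prop)
  exact h.hasDerivAt.comp t hS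

/-- With $u(t,x)=w(S(t),x)$ and $S'=f$, every term of the equation acquires the factor $f$.
Cancelling it leaves the constants $c$, $1$, $d$. -/
theorem reducible_of_proportional {I : Set ℝ} (hI : IsOpen I) (hI' : I.OrdConnected)
    {k f g : ℝ → ℝ} (hc : IsGardnerOn I k f g) {D : Set (ℝ × ℝ × ℝ)} (hD : IsOpen D)
    (hDI : ∀ z ∈ D, z.1 ∈ I) {c d : ℝ} (hd : d ≠ 0)
    (hk : ∀ t ∈ I, k t = c * f t) (hg : ∀ t ∈ I, g t = d * f t) :
    ReducibleToConstant D k f g := by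
  have hf0 : ∀ t ∈ I, f t ≠ 0 := fun t ht => left_ne_zero_of_mul (hc.fg_ne_zero t ht)
  obtain ⟨S, hS, h1, h2, h3⟩ := exists_diffeo_with_deriv hI hI' hc.smooth_f hf0
  obtain ⟨Φ, hΦ, hΦD, hΦS⟩ := exists_time_change hS h1 h2 hD hDI
  refine ⟨Φ, hΦ, hΦD, c, 1, d, ⟨contDiffOn_const, contDiffOn_const, contDiffOn_const,
    by simpa using hd⟩, ?_⟩
  rintro u w ⟨t, x⟩ ⟨hm, hu, hw, hgr⟩
  have hb : ∀ q : ℝ × ℝ, basePoint (Φ (graphPoint u q)) = (S q.1, q.2) := fun q => by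
    rw [hΦS]; rfl
  have ht : t ∈ I := hDI _ (hΦD ▸ hm)
  rw [hb] at hw
  have hev : ∀ᶠ q : ℝ × ℝ in 𝓝 (t, x), u q = w (S q.1, q.2) := by
    filter_upwards [hgr] with q hq
    rw [hb, hΦS] at hq
    exact congrArg (fun z : ℝ × ℝ × ℝ => z.2.2) hq
  have hx : (fun y => u (t, y)) =ᶠ[𝓝 x] fun y => w (S t, y) :=
    (Continuous.prodMk_right t).continuousAt.eventually hev
  have htt : (fun r => u (r, x)) =ᶠ[𝓝 t] fun r => w (S r, x) :=
    (Continuous.prodMk_left x).continuousAt.eventually hev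
  have h4 : deriv (fun r => u (r, x)) t = deriv (fun r => w (r, x)) (S t) * f t := by
    rw [htt.deriv_eq]
    exact (hasDerivAt_time_change hw (h3 t ht)).deriv
  have h5 := hx.deriv_eq
  have h6 : iteratedDeriv 3 (fun y => u (t, y)) x = iteratedDeriv 3 (fun y => w (S t, y)) x :=
    hx.iteratedDeriv_eq 3
  have h7 : u (t, x) = w (S t, x) := hev.self_of_nhds
  simp only [GardnerAt, hb, h4, h5, h6, h7, hk t ht, hg t ht]
  constructor
  · intro h
    apply mul_left_cancel₀ (hf0 t ht)
    linear_combination h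
  · intro h
    linear_combination f t * h

/-! ### Partial derivatives, chain rules along graphs, third-order Taylor expansion -/

section Calculus

/-- The derivative of `F` in the direction `v`, as a function of the point. -/
noncomputable def dirDeriv (v : ℝ × ℝ × ℝ) (F : ℝ × ℝ × ℝ → ℝ) (z : ℝ × ℝ × ℝ) : ℝ :=
  fderiv ℝ F z v

/-- The partial derivative with respect to the first of three variables. -/
noncomputable abbrev pdT := dirDeriv (1, 0, 0)
/-- The partial derivative with respect to the second of three variables. -/
noncomputable abbrev pdX := dirDeriv (0, 1, 0)
/-- The partial derivative with respect to the third of three variables. -/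
noncomputable abbrev pdU := dirDeriv (0, 0, 1)

variable {D : Set (ℝ × ℝ × ℝ)} {F G : ℝ × ℝ × ℝ → ℝ} {v v' z : ℝ × ℝ × ℝ}

theorem ContDiffOn.dirDeriv (hD : IsOpen D) (hF : ContDiffOn ℝ ∞ F D) (v : ℝ × ℝ × ℝ) :
    ContDiffOn ℝ ∞ (dirDeriv v F) D :=
  (hF.fderiv_of_isOpen hD (by simp)).clm_apply contDiffOn_const

theorem ContDiffOn.differentiableAt_of_isOpen (hD : IsOpen D) (hF : ContDiffOn ℝ ∞ F D)
    (hz : z ∈ D) : DifferentiableAt ℝ F z :=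
  (hF.contDiffAt (hD.mem_nhds hz)).differentiableAt (by simp)

theorem dirDeriv_comm (hD : IsOpen D) (hF : ContDiffOn ℝ ∞ F D) (hz : z ∈ D) :
    dirDeriv v (dirDeriv v' F) z = dirDeriv v' (dirDeriv v F) z := by
  have hd : DifferentiableAt ℝ (fderiv ℝ F) z :=
    ((hF.fderiv_of_isOpen hD (m := ∞) (by simp)).contDiffAt (hD.mem_nhds hz)).differentiableAt
      (by simp)
  have h : ∀ a b, dirDeriv a (dirDeriv b F) z = fderiv ℝ (fderiv ℝ F) z a b := fun a b => by
    change fderiv ℝ (fun z => fderiv ℝ F z b) z a = _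
    rw [fderiv_clm_apply hd (differentiableAt_const b)]
    simp
  rw [h, h]
  exact (hF.contDiffAt (hD.mem_nhds hz)).isSymmSndFDerivAt
    (by simp only [minSmoothness_of_isRCLikeNormedField]; norm_cast) v v'

theorem dirDeriv_congr_of_eqOn (hD : IsOpen D) (h : EqOn F G D) (hz : z ∈ D) :
    dirDeriv v F z = dirDeriv v G z := by
  rw [dirDeriv, dirDeriv, (h.eventuallyEq_of_mem (hD.mem_nhds hz)).fderiv_eq]

theorem dirDeriv_eq_zero_of_eqOn (hD : IsOpen D) {c : ℝ} (h : ∀ z ∈ D, F z = c) (hz : z ∈ D) :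
    dirDeriv v F z = 0 := by
  rw [dirDeriv_congr_of_eqOn (G := fun _ => c) hD h hz]
  simp [dirDeriv]

/-- The chain rule along a graph, in the direction of the first variable. -/
theorem hasDerivAt_graph_time {t x ν' : ℝ} {ν : ℝ → ℝ}
    (hF : DifferentiableAt ℝ F (t, x, ν t)) (hν : HasDerivAt ν ν' t) :
    HasDerivAt (fun s => F (s, x, ν s))
      (pdT F (t, x, ν t) + pdU F (t, x, ν t) * ν') t := by
  have h := hF.hasFDerivAt.comp_hasDerivAt t
    ((hasDerivAt_id t).prodMk ((hasDerivAt_const t x).prodMk hν))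
  refine h.congr_deriv ?_
  rw [show ((1 : ℝ), (0 : ℝ), ν') = (1, 0, 0) + ν' • ((0 : ℝ), (0 : ℝ), (1 : ℝ)) by simp,
    map_add, map_smul, smul_eq_mul, mul_comm ν']
  rfl

/-- The chain rule along a graph, in the direction of the second variable. -/
theorem hasDerivAt_graph_space {t x ν' : ℝ} {ν : ℝ → ℝ}
    (hF : DifferentiableAt ℝ F (t, x, ν x)) (hν : HasDerivAt ν ν' x) :
    HasDerivAt (fun y => F (t, y, ν y))
      (pdX F (t, x, ν x) + pdU F (t, x, ν x) * ν') x := by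
  have h := hF.hasFDerivAt.comp_hasDerivAt x
    ((hasDerivAt_const x t).prodMk ((hasDerivAt_id x).prodMk hν))
  refine h.congr_deriv ?_
  rw [show ((0 : ℝ), (1 : ℝ), ν') = (0, 1, 0) + ν' • ((0 : ℝ), (0 : ℝ), (1 : ℝ)) by simp,
    map_add, map_smul, smul_eq_mul, mul_comm ν']
  rfl

theorem iteratedDeriv_three_of_hasDerivAt {η η₁ η₂ : ℝ → ℝ} {c x : ℝ}
    (h₁ : ∀ᶠ y in 𝓝 x, HasDerivAt η (η₁ y) y) (h₂ : ∀ᶠ y in 𝓝 x, HasDerivAt η₁ (η₂ y) y)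
    (h₃ : HasDerivAt η₂ c x) : iteratedDeriv 3 η x = c := by
  have e₁ : deriv η =ᶠ[𝓝 x] η₁ := h₁.mono fun y hy => hy.deriv
  have e₂ : deriv η₁ =ᶠ[𝓝 x] η₂ := h₂.mono fun y hy => hy.deriv
  rw [iteratedDeriv_succ', e₁.iteratedDeriv_eq, iteratedDeriv_succ', e₂.iteratedDeriv_eq,
    iteratedDeriv_one, h₃.deriv]

theorem ContDiffAt.eventually_hasDerivAt {ρ : ℝ → ℝ} {x : ℝ} (h : ContDiffAt ℝ ∞ ρ x) :
    ∀ᶠ y in 𝓝 x, HasDerivAt ρ (deriv ρ y) y := by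
  have h1 : ContDiffAt ℝ 1 ρ x := h.of_le (by simp)
  filter_upwards [h1.eventually (by simp)] with y hy
  exact (hy.differentiableAt (by simp)).hasDerivAt

theorem ContDiffAt.deriv_infty {ρ : ℝ → ℝ} {x : ℝ} (h : ContDiffAt ℝ ∞ ρ x) :
    ContDiffAt ℝ ∞ (deriv ρ) x := by
  change ContDiffAt ℝ ∞ (fun y => fderiv ℝ ρ y 1) x
  exact (h.fderiv_right (by simp)).clm_apply contDiffAt_const

/-- A term of the third derivative survives at `x` only if each of the three vanishing factors is
differentiated once. Such cubes serve as perturbations that alter the third derivative but neither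
the value nor the first derivative. -/
theorem iteratedDeriv_three_sub_pow_three {ρ : ℝ → ℝ} {x : ℝ} (h : ContDiffAt ℝ ∞ ρ x) :
    iteratedDeriv 3 (fun y => (ρ y - ρ x) ^ 3) x = 6 * deriv ρ x ^ 3 := by
  have h1 := h.eventually_hasDerivAt
  have h2 := h.deriv_infty.eventually_hasDerivAt
  have h3 := h.deriv_infty.deriv_infty.eventually_hasDerivAt.self_of_nhds
  refine iteratedDeriv_three_of_hasDerivAt (η₁ := fun y => 3 * (ρ y - ρ x) ^ 2 * deriv ρ y)
    (η₂ := fun y => 6 * (ρ y - ρ x) * deriv ρ y ^ 2 + 3 * (ρ y - ρ x) ^ 2 * deriv (deriv ρ) y)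
    ?_ ?_ ?_
  · filter_upwards [h1] with y hy
    exact ((hy.sub_const (ρ x)).fun_pow 3).congr_deriv (by norm_num)
  · filter_upwards [h1, h2] with y hy hy2
    exact ((((hy.sub_const (ρ x)).fun_pow 2).const_mul 3).fun_mul hy2).congr_deriv
      (by push_cast; ring)
  · have a := h1.self_of_nhds
    have b := h2.self_of_nhds
    exact ((((a.sub_const (ρ x)).const_mul 6).fun_mul (b.fun_pow 2)).fun_add
      ((((a.sub_const (ρ x)).fun_pow 2).const_mul 3).fun_mul h3)).congr_deriv
      (by push_cast; ring)

theorem hasDerivAt_sub_pow_three {ρ : ℝ → ℝ} {x : ℝ} (h : ContDiffAt ℝ ∞ ρ x) :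
    HasDerivAt (fun y => (ρ y - ρ x) ^ 3) 0 x := by
  exact ((h.eventually_hasDerivAt.self_of_nhds.sub_const (ρ x)).fun_pow 3).congr_deriv (by simp)

theorem eq_zero_of_eq_pow_mul {p Q : ℝ → ℝ} {x : ℝ} (hp : ContinuousAt p x) (m : ℕ)
    (hQ : Tendsto Q (𝓝[≠] x) (𝓝 0)) (h : ∀ y, y ≠ x → p y = (y - x) ^ m * Q y) : p x = 0 := by
  have h1 : Tendsto (fun y => (y - x) ^ m * Q y) (𝓝[≠] x) (𝓝 ((x - x) ^ m * 0)) :=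
    Tendsto.mul ((by fun_prop : Continuous fun y : ℝ => (y - x) ^ m).continuousAt.tendsto.mono_left
      nhdsWithin_le_nhds) hQ
  rw [mul_zero] at h1
  refine tendsto_nhds_unique (hp.tendsto.mono_left nhdsWithin_le_nhds) (h1.congr' ?_)
  filter_upwards [self_mem_nhdsWithin] with y hy using (h y hy).symm

/-- The quotient by $(y-x)^3$ tends to zero. Multiplying it back by $(y-x)^m$ for $m=3,2,1,0$
removes the coefficients one after another, starting from the constant term. -/
theorem coeff_eq_zero_of_isLittleO {a₀ a₁ a₂ a₃ x : ℝ}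
    (h : (fun y => a₀ + a₁ * (y - x) + a₂ * (y - x) ^ 2 + a₃ * (y - x) ^ 3) =o[𝓝 x]
      fun y => (y - x) ^ 3) : a₁ = 0 ∧ a₃ = 0 := by
  have hQ := (h.tendsto_div_nhds_zero).mono_left (nhdsWithin_le_nhds (s := {x}ᶜ))
  have h₀ : a₀ = 0 := by
    have := eq_zero_of_eq_pow_mul (x := x)
      (p := fun y => a₀ + a₁ * (y - x) + a₂ * (y - x) ^ 2 + a₃ * (y - x) ^ 3)
      (by fun_prop) 3 hQ fun y hy => by
        have := sub_ne_zero.2 hy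
        field_simp
    simpa using this
  have h₁ : a₁ = 0 := by
    have := eq_zero_of_eq_pow_mul (x := x) (p := fun y => a₁ + a₂ * (y - x) + a₃ * (y - x) ^ 2)
      (by fun_prop) 2 hQ fun y hy => by
        have := sub_ne_zero.2 hy
        simp only [h₀]
        field_simp
        ring
    simpa using this
  have h₂ : a₂ = 0 := by
    have := eq_zero_of_eq_pow_mul (x := x) (p := fun y => a₂ + a₃ * (y - x))
      (by fun_prop) 1 hQ fun y hy => by
        have := sub_ne_zero.2 hy
        simp only [h₀, h₁]
        field_simp
        ring
    simpa using this
  have h₃ : a₃ = 0 := by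
    have := eq_zero_of_eq_pow_mul (x := x) (p := fun _ => a₃) (by fun_prop) 0 hQ fun y hy => by
        have := sub_ne_zero.2 hy
        simp only [h₀, h₁, h₂]
        field_simp
        ring
    simpa using this
  exact ⟨h₁, h₃⟩

/-- A smooth function that vanishes to higher than third order has vanishing third-order jet. -/
theorem jet_eq_zero_of_isLittleO {e : ℝ → ℝ} {x : ℝ} (he : ContDiffAt ℝ ∞ e x)
    (h : e =o[𝓝 x] fun y => (y - x) ^ 3) : deriv e x = 0 ∧ iteratedDeriv 3 e x = 0 := by
  obtain ⟨s, hs, hes⟩ := (he.of_le (m := 3) (by norm_cast)).contDiffOn le_rfl (by simp)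
  obtain ⟨ε, hε, hball⟩ := Metric.mem_nhds_iff.1 (by simpa using hs)
  have hx : x ∈ Metric.ball x ε := Metric.mem_ball_self hε
  have ht := taylor_isLittleO (n := 3) (convex_ball x ε) hx (hes.mono hball)
  rw [Metric.isOpen_ball.nhdsWithin_eq hx] at ht
  have hw : ∀ n, iteratedDerivWithin n e (Metric.ball x ε) x = iteratedDeriv n e x := fun n =>
    iteratedDerivWithin_of_isOpen Metric.isOpen_ball hx
  -- Both `e` and its Taylor remainder are $o((y-x)^3)$, hence so is the Taylor polynomial.
  have hp := h.sub ht
  simp only [sub_sub_cancel, taylorWithinEval_succ, taylor_within_zero_eval, hw] at hp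
  norm_num [Nat.factorial] at hp
  have hc := coeff_eq_zero_of_isLittleO (a₀ := e x) (a₁ := deriv e x)
    (a₂ := iteratedDeriv 2 e x / 2) (a₃ := iteratedDeriv 3 e x / 6) (x := x)
    (hp.congr_left fun y => by ring)
  exact ⟨hc.1, by simpa using hc.2⟩

end Calculus

/-! ### Derivatives of functions of $(t,x)$ -/

section Jets

/-- The partial derivative with respect to `t` of a function of `(t, x)`. -/
noncomputable def timeDeriv (u : ℝ × ℝ → ℝ) (p : ℝ × ℝ) : ℝ := deriv (fun s => u (s, p.2)) p.1

/-- The partial derivative with respect to `x` of a function of `(t, x)`. -/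
noncomputable def spaceDeriv (u : ℝ × ℝ → ℝ) (p : ℝ × ℝ) : ℝ := deriv (fun y => u (p.1, y)) p.2

/-- The third partial derivative with respect to `x` of a function of `(t, x)`. -/
noncomputable def spaceDeriv₃ (u : ℝ × ℝ → ℝ) (p : ℝ × ℝ) : ℝ :=
  iteratedDeriv 3 (fun y => u (p.1, y)) p.2

variable {u w h : ℝ × ℝ → ℝ} {p : ℝ × ℝ}

theorem gardnerAt_iff {k f g : ℝ → ℝ} : GardnerAt k f g u p ↔
    timeDeriv u p + k p.1 * u p * spaceDeriv u p + f p.1 * u p ^ 2 * spaceDeriv u p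
      + g p.1 * spaceDeriv₃ u p = 0 := Iff.rfl

theorem ContDiffAt.comp_time (hu : ContDiffAt ℝ ∞ u p) :
    ContDiffAt ℝ ∞ (fun s => u (s, p.2)) p.1 :=
  ContDiffAt.comp (f := fun s : ℝ => (s, p.2)) p.1 hu (by fun_prop)

theorem ContDiffAt.comp_space (hu : ContDiffAt ℝ ∞ u p) :
    ContDiffAt ℝ ∞ (fun y => u (p.1, y)) p.2 :=
  ContDiffAt.comp (f := fun y : ℝ => (p.1, y)) p.2 hu (by fun_prop)

theorem ContDiffAt.hasDerivAt_time (hu : ContDiffAt ℝ ∞ u p) :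
    HasDerivAt (fun s => u (s, p.2)) (timeDeriv u p) p.1 :=
  (hu.comp_time.differentiableAt (by simp)).hasDerivAt

theorem ContDiffAt.hasDerivAt_space (hu : ContDiffAt ℝ ∞ u p) :
    HasDerivAt (fun y => u (p.1, y)) (spaceDeriv u p) p.2 :=
  (hu.comp_space.differentiableAt (by simp)).hasDerivAt

theorem fderiv_apply_eq_of_differentiableAt (hu : DifferentiableAt ℝ u p) (v : ℝ × ℝ) :
    fderiv ℝ u p v = timeDeriv u p * v.1 + spaceDeriv u p * v.2 := by
  have h1 : timeDeriv u p = fderiv ℝ u p (1, 0) := by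
    have h0 : HasFDerivAt u (fderiv ℝ u p) (p.1, p.2) := hu.hasFDerivAt
    exact (h0.comp_hasDerivAt p.1 ((hasDerivAt_id _).prodMk (hasDerivAt_const _ p.2))).deriv
  have h2 : spaceDeriv u p = fderiv ℝ u p (0, 1) := by
    have h0 : HasFDerivAt u (fderiv ℝ u p) (p.1, p.2) := hu.hasFDerivAt
    exact (h0.comp_hasDerivAt p.2 ((hasDerivAt_const _ p.1).prodMk (hasDerivAt_id _))).deriv
  obtain ⟨a, b⟩ := v
  rw [h1, h2, show ((a, b) : ℝ × ℝ) = a • ((1 : ℝ), (0 : ℝ)) + b • ((0 : ℝ), (1 : ℝ)) by simp,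
    map_add, map_smul, map_smul]
  simp [mul_comm]

theorem hasDerivAt_comp_pair {ρ σ : ℝ → ℝ} {ρ' σ' s : ℝ} (hd : DifferentiableAt ℝ w (ρ s, σ s))
    (hρ : HasDerivAt ρ ρ' s) (hσ : HasDerivAt σ σ' s) :
    HasDerivAt (fun r => w (ρ r, σ r))
      (timeDeriv w (ρ s, σ s) * ρ' + spaceDeriv w (ρ s, σ s) * σ') s := by
  refine (hd.hasFDerivAt.comp_hasDerivAt s (hρ.prodMk hσ)).congr_deriv ?_
  exact fderiv_apply_eq_of_differentiableAt hd (ρ', σ')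

theorem timeDeriv_add (hu : ContDiffAt ℝ ∞ u p) (hh : ContDiffAt ℝ ∞ h p) :
    timeDeriv (fun q => u q + h q) p = timeDeriv u p + timeDeriv h p :=
  (hu.hasDerivAt_time.fun_add hh.hasDerivAt_time).deriv

theorem spaceDeriv_add (hu : ContDiffAt ℝ ∞ u p) (hh : ContDiffAt ℝ ∞ h p) :
    spaceDeriv (fun q => u q + h q) p = spaceDeriv u p + spaceDeriv h p :=
  (hu.hasDerivAt_space.fun_add hh.hasDerivAt_space).deriv

theorem spaceDeriv₃_add (hu : ContDiffAt ℝ ∞ u p) (hh : ContDiffAt ℝ ∞ h p) :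
    spaceDeriv₃ (fun q => u q + h q) p = spaceDeriv₃ u p + spaceDeriv₃ h p :=
  iteratedDeriv_fun_add (hu.comp_space.of_le (by norm_cast))
    (hh.comp_space.of_le (by norm_cast))

theorem contDiffAt_comp_graphPoint {F : ℝ × ℝ × ℝ → ℝ} (hF : ContDiffAt ℝ ∞ F (graphPoint u p))
    (hu : ContDiffAt ℝ ∞ u p) : ContDiffAt ℝ ∞ (fun q => F (graphPoint u q)) p :=
  ContDiffAt.comp p hF (contDiffAt_fst.prodMk (contDiffAt_snd.prodMk hu))

theorem timeDeriv_comp_graphPoint {F : ℝ × ℝ × ℝ → ℝ} (hF : ContDiffAt ℝ ∞ F (graphPoint u p))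
    (hu : ContDiffAt ℝ ∞ u p) : timeDeriv (fun q => F (graphPoint u q)) p =
      pdT F (graphPoint u p) + pdU F (graphPoint u p) * timeDeriv u p :=
  (hasDerivAt_graph_time (F := F) (ν := fun s => u (s, p.2)) (hF.differentiableAt (by simp))
    hu.hasDerivAt_time).deriv

theorem spaceDeriv_comp_graphPoint {F : ℝ × ℝ × ℝ → ℝ} (hF : ContDiffAt ℝ ∞ F (graphPoint u p))
    (hu : ContDiffAt ℝ ∞ u p) : spaceDeriv (fun q => F (graphPoint u q)) p =
      pdX F (graphPoint u p) + pdU F (graphPoint u p) * spaceDeriv u p :=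
  (hasDerivAt_graph_space (F := F) (ν := fun y => u (p.1, y)) (hF.differentiableAt (by simp))
    hu.hasDerivAt_space).deriv

end Jets

/-! ### Polynomials with prescribed jets -/

section Cubic

/-- A polynomial in `(t, x)` with prescribed value and derivatives at a point. -/
noncomputable def cubicJet (p : ℝ × ℝ) (c τ a b r : ℝ) (q : ℝ × ℝ) : ℝ :=
  c + τ * (q.1 - p.1) + a * (q.2 - p.2) + b / 2 * (q.2 - p.2) ^ 2 + r / 6 * (q.2 - p.2) ^ 3

variable (p : ℝ × ℝ) (c τ a b r : ℝ)

theorem contDiff_cubicJet : ContDiff ℝ ∞ (cubicJet p c τ a b r) := by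
  unfold cubicJet; fun_prop

@[simp] theorem cubicJet_self : cubicJet p c τ a b r p = c := by simp [cubicJet]

@[simp] theorem graphPoint_cubicJet :
    graphPoint (cubicJet p c τ a b r) p = (p.1, p.2, c) := by simp [graphPoint]

theorem hasDerivAt_cubicJet_space (y : ℝ) :
    HasDerivAt (fun y => cubicJet p c τ a b r (p.1, y))
      (a + b * (y - p.2) + r / 2 * (y - p.2) ^ 2) y := by
  have h := (hasDerivAt_id y).sub_const p.2
  simp only [cubicJet]
  exact (((((h.const_mul a).const_add (c + τ * (p.1 - p.1))).fun_add
    ((h.fun_pow 2).const_mul (b / 2)))).fun_add ((h.fun_pow 3).const_mul (r / 6))).congr_deriv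
    (by push_cast; simp; ring)

@[simp] theorem timeDeriv_cubicJet : timeDeriv (cubicJet p c τ a b r) p = τ := by
  have h := (hasDerivAt_id p.1).sub_const p.1
  refine HasDerivAt.deriv ?_
  simp only [cubicJet]
  exact (((((h.const_mul τ).const_add c).add_const (a * (p.2 - p.2))).add_const
    (b / 2 * (p.2 - p.2) ^ 2)).add_const (r / 6 * (p.2 - p.2) ^ 3)).congr_deriv (by simp)

@[simp] theorem spaceDeriv_cubicJet : spaceDeriv (cubicJet p c τ a b r) p = a := by
  rw [spaceDeriv, (hasDerivAt_cubicJet_space p c τ a b r p.2).deriv]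
  simp

@[simp] theorem spaceDeriv₃_cubicJet : spaceDeriv₃ (cubicJet p c τ a b r) p = r := by
  refine iteratedDeriv_three_of_hasDerivAt (η₂ := fun y => b + r * (y - p.2))
    (Eventually.of_forall fun y => hasDerivAt_cubicJet_space p c τ a b r y)
    (Eventually.of_forall fun y => ?_) ?_
  · have h := (hasDerivAt_id y).sub_const p.2
    exact (((h.const_mul b).const_add a).fun_add ((h.fun_pow 2).const_mul (r / 2))).congr_deriv
      (by push_cast; simp; ring)
  · exact ((((hasDerivAt_id p.2).sub_const p.2).const_mul r).const_add b).congr_deriv (by simp)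

end Cubic

/-! ### Components of a point transformation and transformed graphs -/

section Transformations

/-- `T`, `X`, `U` are the components of a point transformation: they are smooth and have
nonvanishing Jacobian determinant. -/
structure IsComponents (Φ : OpenPartialHomeomorph (ℝ × ℝ × ℝ) (ℝ × ℝ × ℝ))
    (T X U : ℝ × ℝ × ℝ → ℝ) : Prop where
  eq : ∀ z, Φ z = (T z, X z, U z)
  smooth_T : ContDiffOn ℝ ∞ T Φ.source
  smooth_X : ContDiffOn ℝ ∞ X Φ.source
  smooth_U : ContDiffOn ℝ ∞ U Φ.source
  det_ne_zero : ∀ z ∈ Φ.source,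
    pdT T z * (pdX X z * pdU U z - pdU X z * pdX U z)
      - pdX T z * (pdT X z * pdU U z - pdU X z * pdT U z)
      + pdU T z * (pdT X z * pdX U z - pdX X z * pdT U z) ≠ 0

theorem fderiv_apply_eq_dirDeriv (F : ℝ × ℝ × ℝ → ℝ) (z v : ℝ × ℝ × ℝ) :
    fderiv ℝ F z v = pdT F z * v.1 + pdX F z * v.2.1 + pdU F z * v.2.2 := by
  obtain ⟨a, b, c⟩ := v
  rw [show ((a, b, c) : ℝ × ℝ × ℝ) = a • ((1 : ℝ), (0 : ℝ), (0 : ℝ)) +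
    b • ((0 : ℝ), (1 : ℝ), (0 : ℝ)) + c • ((0 : ℝ), (0 : ℝ), (1 : ℝ)) by simp,
    map_add, map_add, map_smul, map_smul, map_smul]
  simp [dirDeriv, mul_comm]

theorem IsPointTransformation.isComponents
    {Φ : OpenPartialHomeomorph (ℝ × ℝ × ℝ) (ℝ × ℝ × ℝ)} (hΦ : IsPointTransformation Φ) :
    IsComponents Φ (fun z => (Φ z).1) (fun z => (Φ z).2.1) (fun z => (Φ z).2.2) := by
  have hs := hΦ.smooth
  refine ⟨fun z => rfl, hs.fst, hs.snd.fst, hs.snd.snd, fun z hz => ?_⟩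
  have hd : DifferentiableAt ℝ Φ z :=
    (hs.contDiffAt (Φ.open_source.mem_nhds hz)).differentiableAt (by simp)
  have hd' : DifferentiableAt ℝ Φ.symm (Φ z) :=
    (hΦ.smooth_symm.contDiffAt (Φ.open_target.mem_nhds (Φ.map_source hz))).differentiableAt
      (by simp)
  have hcomp : (fderiv ℝ Φ.symm (Φ z)).comp (fderiv ℝ Φ z) = ContinuousLinearMap.id ℝ _ := by
    have hl : Φ.symm ∘ Φ =ᶠ[𝓝 z] fun y => y := Φ.eventually_left_inverse hz
    rw [← fderiv_comp z hd' hd, hl.fderiv_eq]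
    exact fderiv_fun_id
  have hL : ∀ v, fderiv ℝ Φ z v = (fderiv ℝ (fun z => (Φ z).1) z v,
      fderiv ℝ (fun z => (Φ z).2.1) z v, fderiv ℝ (fun z => (Φ z).2.2) z v) := fun v => by
    rw [hd.hasFDerivAt.fst.fderiv, hd.hasFDerivAt.snd.fst.fderiv, hd.hasFDerivAt.snd.snd.fderiv]
    rfl
  set T : ℝ × ℝ × ℝ → ℝ := fun z => (Φ z).1
  set X : ℝ × ℝ × ℝ → ℝ := fun z => (Φ z).2.1
  set U : ℝ × ℝ × ℝ → ℝ := fun z => (Φ z).2.2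
  let A : Matrix (Fin 3) (Fin 3) ℝ := !![pdT T z, pdX T z, pdU T z; pdT X z, pdX X z, pdU X z;
    pdT U z, pdX U z, pdU U z]
  -- A kernel vector of the Jacobian matrix would be annihilated by the derivative of `Φ`, which has
  -- the derivative of `Φ.symm` as a left inverse.
  have hA : A.det ≠ 0 := by
    intro h0
    obtain ⟨v, hv, hAv⟩ := Matrix.exists_mulVec_eq_zero_iff.2 h0
    have hker : fderiv ℝ Φ z (v 0, v 1, v 2) = 0 := by
      have e0 := congrFun hAv 0
      have e1 := congrFun hAv 1
      have e2 := congrFun hAv 2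
      simp [A, Matrix.mulVec, dotProduct, Fin.sum_univ_three] at e0 e1 e2
      rw [hL, fderiv_apply_eq_dirDeriv, fderiv_apply_eq_dirDeriv, fderiv_apply_eq_dirDeriv,
        e0, e1, e2]
      rfl
    have h1 := congrArg (fun L : ℝ × ℝ × ℝ →L[ℝ] ℝ × ℝ × ℝ => L (v 0, v 1, v 2)) hcomp
    simp only [ContinuousLinearMap.comp_apply, hker, map_zero, ContinuousLinearMap.id_apply,
      Prod.ext_iff] at h1
    apply hv
    ext i
    fin_cases i
    · exact h1.1.symm
    · exact h1.2.1.symm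
    · exact h1.2.2.symm
  intro h0
  apply hA
  rw [Matrix.det_fin_three]
  simp only [A, Matrix.of_apply, Matrix.cons_val]
  linear_combination h0

variable {Φ : OpenPartialHomeomorph (ℝ × ℝ × ℝ) (ℝ × ℝ × ℝ)} {T X U : ℝ × ℝ × ℝ → ℝ}
  {u w : ℝ × ℝ → ℝ} {p : ℝ × ℝ}

theorem contDiffAt_of_mem_source (hT : ContDiffOn ℝ ∞ T Φ.source) {z : ℝ × ℝ × ℝ}
    (hz : z ∈ Φ.source) : ContDiffAt ℝ ∞ T z :=
  hT.contDiffAt (Φ.open_source.mem_nhds hz)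

/-- A function whose graph is transversal to the fibres of `basePoint ∘ Φ` is transformed by `Φ`
to a smooth function of the new variables. -/
theorem exists_transformsAt (hΦ : IsComponents Φ T X U) (hu : ContDiffAt ℝ ∞ u p)
    {z : ℝ × ℝ × ℝ} (hzu : graphPoint u p = z) (hp : z ∈ Φ.source)
    (hΔ : (pdT T z + pdU T z * timeDeriv u p) * (pdX X z + pdU X z * spaceDeriv u p)
      - (pdX T z + pdU T z * spaceDeriv u p) * (pdT X z + pdU X z * timeDeriv u p) ≠ 0) :
    ∃ w, TransformsAt Φ u w p ∧ map (fun q => (T (graphPoint u q), X (graphPoint u q))) (𝓝 p) =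
      𝓝 (T z, X z) := by
  subst hzu
  have hT := contDiffAt_of_mem_source hΦ.smooth_T hp
  have hX := contDiffAt_of_mem_source hΦ.smooth_X hp
  have hU := contDiffAt_of_mem_source hΦ.smooth_U hp
  have hTγ := contDiffAt_comp_graphPoint hT hu
  have hXγ := contDiffAt_comp_graphPoint hX hu
  rw [← timeDeriv_comp_graphPoint hT hu, ← timeDeriv_comp_graphPoint hX hu,
    ← spaceDeriv_comp_graphPoint hT hu, ← spaceDeriv_comp_graphPoint hX hu] at hΔ
  set φ : ℝ × ℝ → ℝ × ℝ := fun q => (T (graphPoint u q), X (graphPoint u q)) with hφdef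
  have hφ : ContDiffAt ℝ ∞ φ p := hTγ.prodMk hXγ
  have hdT := hTγ.differentiableAt (by simp)
  have hdX := hXγ.differentiableAt (by simp)
  have hd : HasFDerivAt φ ((fderiv ℝ (fun q => T (graphPoint u q)) p).prod
      (fderiv ℝ (fun q => X (graphPoint u q)) p)) p :=
    hdT.hasFDerivAt.prodMk hdX.hasFDerivAt
  set L := (fderiv ℝ (fun q => T (graphPoint u q)) p).prod
      (fderiv ℝ (fun q => X (graphPoint u q)) p)
  -- The quantity in `hΔ` is the determinant of `L`; Cramer's rule gives a trivial kernel.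
  have hinj : Function.Injective (L : ℝ × ℝ →ₗ[ℝ] ℝ × ℝ) := by
    rw [← LinearMap.ker_eq_bot, LinearMap.ker_eq_bot']
    rintro ⟨a, b⟩ hab
    have hab' : L (a, b) = 0 := hab
    have h1 := congrArg Prod.fst hab'
    have h2 := congrArg Prod.snd hab'
    simp only [L, ContinuousLinearMap.prod_apply, fderiv_apply_eq_of_differentiableAt hdT,
      fderiv_apply_eq_of_differentiableAt hdX, Prod.fst_zero, Prod.snd_zero] at h1 h2
    ext
    · refine (mul_eq_zero.1 ?_).resolve_left hΔ
      linear_combination spaceDeriv (fun q => X (graphPoint u q)) p * h1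
        - spaceDeriv (fun q => T (graphPoint u q)) p * h2
    · refine (mul_eq_zero.1 ?_).resolve_left hΔ
      linear_combination timeDeriv (fun q => T (graphPoint u q)) p * h2
        - timeDeriv (fun q => X (graphPoint u q)) p * h1
  let E : (ℝ × ℝ) ≃L[ℝ] ℝ × ℝ :=
    (LinearEquiv.ofInjectiveEndo (L : ℝ × ℝ →ₗ[ℝ] ℝ × ℝ) hinj).toContinuousLinearEquiv
  have hE : HasFDerivAt φ (E : ℝ × ℝ →L[ℝ] ℝ × ℝ) p := by
    convert hd using 1
    exact ContinuousLinearMap.ext fun v => rfl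
  have hstrict := hφ.hasStrictFDerivAt' hE (by simp)
  -- This equality of filters later turns relations that hold along the graph of `u` into relations
  -- between functions of the new variables.
  have hmap := hstrict.map_nhds_eq_of_equiv
  have hb : ∀ q, basePoint (Φ (graphPoint u q)) = φ q := fun q => by rw [hΦ.eq]; rfl
  have hinv := hφ.to_localInverse hE (by simp)
  have hinvp := hφ.localInverse_apply_image hE (by simp)
  have hleft : ∀ᶠ q in 𝓝 p, hφ.localInverse hE (by simp) (φ q) = q :=
    hstrict.eventually_left_inverse
  -- The transformed function is the new dependent variable along the graph, read in the new
  -- coordinates through the local inverse of `φ`.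
  refine ⟨fun y => U (graphPoint u (hφ.localInverse hE (by simp) y)),
    ⟨hp, hu, ?_, ?_⟩, hmap⟩
  · rw [hb]
    refine ContDiffAt.comp (g := fun q => U (graphPoint u q)) (φ p) ?_ hinv
    rw [hinvp]
    exact contDiffAt_comp_graphPoint hU hu
  · filter_upwards [hleft] with q hq
    rw [hb, hΦ.eq]
    change _ = ((φ q).1, (φ q).2, U (graphPoint u (hφ.localInverse hE (by simp) (φ q))))
    rw [hq]

variable (hΦ : IsComponents Φ T X U) (h : TransformsAt Φ u w p)
include hΦ h

theorem TransformsAt.eventually_eq :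
    ∀ᶠ q in 𝓝 p, w (T (graphPoint u q), X (graphPoint u q)) = U (graphPoint u q) := by
  filter_upwards [h.graph] with q hq
  rw [hΦ.eq] at hq
  exact (congrArg (fun z : ℝ × ℝ × ℝ => z.2.2) hq).symm

theorem TransformsAt.contDiffAt_right :
    ContDiffAt ℝ ∞ w (T (graphPoint u p), X (graphPoint u p)) := by
  have := h.smooth_right
  rwa [hΦ.eq] at this

/-- Differentiation of $w(T,X)=U$ along the graph. With `TransformsAt.space_eq` it forms a linear
system for the first derivatives of `w`, solvable when the determinant in `exists_transformsAt` is
nonzero. -/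
theorem TransformsAt.time_eq {z : ℝ × ℝ × ℝ} (hz : graphPoint u p = z) :
    timeDeriv w (T z, X z) * (pdT T z + pdU T z * timeDeriv u p)
      + spaceDeriv w (T z, X z) * (pdT X z + pdU X z * timeDeriv u p)
      = pdT U z + pdU U z * timeDeriv u p := by
  subst hz
  have hT := contDiffAt_of_mem_source hΦ.smooth_T h.mem_source
  have hX := contDiffAt_of_mem_source hΦ.smooth_X h.mem_source
  have hU := contDiffAt_of_mem_source hΦ.smooth_U h.mem_source
  have hu := h.smooth_left
  rw [← timeDeriv_comp_graphPoint hT hu, ← timeDeriv_comp_graphPoint hX hu,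
    ← timeDeriv_comp_graphPoint hU hu]
  have hev : (fun s => w (T (graphPoint u (s, p.2)), X (graphPoint u (s, p.2)))) =ᶠ[𝓝 p.1]
      fun s => U (graphPoint u (s, p.2)) :=
    (Continuous.prodMk_left p.2).continuousAt.eventually (h.eventually_eq hΦ)
  refine Eq.trans ?_ hev.deriv_eq
  exact (hasDerivAt_comp_pair (ρ := fun s => T (graphPoint u (s, p.2)))
    (σ := fun s => X (graphPoint u (s, p.2))) ((h.contDiffAt_right hΦ).differentiableAt (by simp))
    (contDiffAt_comp_graphPoint hT hu).hasDerivAt_time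
    (contDiffAt_comp_graphPoint hX hu).hasDerivAt_time).deriv.symm

theorem TransformsAt.space_eq {z : ℝ × ℝ × ℝ} (hz : graphPoint u p = z) :
    timeDeriv w (T z, X z) * (pdX T z + pdU T z * spaceDeriv u p)
      + spaceDeriv w (T z, X z) * (pdX X z + pdU X z * spaceDeriv u p)
      = pdX U z + pdU U z * spaceDeriv u p := by
  subst hz
  have hT := contDiffAt_of_mem_source hΦ.smooth_T h.mem_source
  have hX := contDiffAt_of_mem_source hΦ.smooth_X h.mem_source
  have hU := contDiffAt_of_mem_source hΦ.smooth_U h.mem_source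
  have hu := h.smooth_left
  rw [← spaceDeriv_comp_graphPoint hT hu, ← spaceDeriv_comp_graphPoint hX hu,
    ← spaceDeriv_comp_graphPoint hU hu]
  have hev : (fun s => w (T (graphPoint u (p.1, s)), X (graphPoint u (p.1, s)))) =ᶠ[𝓝 p.2]
      fun s => U (graphPoint u (p.1, s)) :=
    (Continuous.prodMk_right p.1).continuousAt.eventually (h.eventually_eq hΦ)
  refine Eq.trans ?_ hev.deriv_eq
  exact (hasDerivAt_comp_pair (ρ := fun s => T (graphPoint u (p.1, s)))
    (σ := fun s => X (graphPoint u (p.1, s))) ((h.contDiffAt_right hΦ).differentiableAt (by simp))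
    (contDiffAt_comp_graphPoint hT hu).hasDerivAt_space
    (contDiffAt_comp_graphPoint hX hu).hasDerivAt_space).deriv.symm

end Transformations

/-! ### Perturbation of graphs: the form of $T$ and $X$ -/

section Perturbation

variable {Φ : OpenPartialHomeomorph (ℝ × ℝ × ℝ) (ℝ × ℝ × ℝ)} {T X U : ℝ × ℝ × ℝ → ℝ}
  {k f g : ℝ → ℝ} {k' f' g' : ℝ} {z : ℝ × ℝ × ℝ}

/-- When `h` has zero value and zero `x`-derivative at `p`, the nonlinear terms are unaffected, so
the left side of the equation changes only by the linear terms in `h`. -/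
theorem gardnerAt_add_iff {u h : ℝ × ℝ → ℝ} {p : ℝ × ℝ} (hu : ContDiffAt ℝ ∞ u p)
    (hh : ContDiffAt ℝ ∞ h p) (h₀ : h p = 0) (h₁ : spaceDeriv h p = 0)
    (hG : GardnerAt k f g u p) :
    GardnerAt k f g (fun q => u q + h q) p ↔ timeDeriv h p + g p.1 * spaceDeriv₃ h p = 0 := by
  rw [gardnerAt_iff] at hG ⊢
  rw [timeDeriv_add hu hh, spaceDeriv_add hu hh, spaceDeriv₃_add hu hh, h₀, h₁]
  constructor <;> intro h'
  · linear_combination h' - hG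
  · linear_combination h' + hG

theorem gardnerAt_cubicJet (c a b : ℝ) (p : ℝ × ℝ) :
    GardnerAt k f g (cubicJet p c (-(k p.1 * c + f p.1 * c ^ 2) * a) a b 0) p := by
  rw [gardnerAt_iff]
  simp only [timeDeriv_cubicJet, spaceDeriv_cubicJet, spaceDeriv₃_cubicJet, cubicJet_self]
  ring

/-- Perturb `u` by the cube of the increment of $T$ along its graph. The transformed function is
unchanged on the line $\tilde t=T(z)$, and its $\tilde t$-derivative at the image point is unchanged
since the first-order jet of `u` is. The target equation therefore still holds, whereas (1) changes
by $6g(D_xT)^3$. -/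
theorem MapsGardner.total_pdX_eq_zero (hΦ : IsComponents Φ T X U)
    (hm : MapsGardner Φ k f g (fun _ => k') (fun _ => f') (fun _ => g'))
    (hz : z ∈ Φ.source) (hg : g z.1 ≠ 0) {τ a : ℝ}
    (hΔ : (pdT T z + pdU T z * τ) * (pdX X z + pdU X z * a)
      - (pdX T z + pdU T z * a) * (pdT X z + pdU X z * τ) ≠ 0) :
    pdX T z + pdU T z * a = 0 := by
  obtain ⟨t, x, c⟩ := z
  simp only at hg
  set p : ℝ × ℝ := (t, x) with hp
  set z : ℝ × ℝ × ℝ := (t, x, c) with hzdef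
  -- The third derivative is chosen so that (1) holds at `p`, leaving `τ` and `a` free.
  set u := cubicJet p c τ a 0 (-(τ + k t * c * a + f t * c ^ 2 * a) / g t) with hudef
  have hus : ContDiffAt ℝ ∞ u p := (contDiff_cubicJet ..).contDiffAt
  have huz : graphPoint u p = z := by simp [u, hp, hzdef]
  have hut : timeDeriv u p = τ := by simp [u]
  have hux : spaceDeriv u p = a := by simp [u]
  have hGu : GardnerAt k f g u p := by
    rw [gardnerAt_iff, hut, hux, hudef, spaceDeriv₃_cubicJet, cubicJet_self]
    simp only [hp]
    field_simp
    ring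
  have hTs := contDiffAt_of_mem_source hΦ.smooth_T hz
  have hρ : ContDiffAt ℝ ∞ (fun q => T (graphPoint u q)) p :=
    contDiffAt_comp_graphPoint (huz ▸ hTs) hus
  set ρ := fun q => T (graphPoint u q) with hρdef
  have hρx : spaceDeriv ρ p = pdX T z + pdU T z * a := by
    rw [hρdef, spaceDeriv_comp_graphPoint (huz ▸ hTs) hus, huz, hux]
  set h : ℝ × ℝ → ℝ := fun q => (ρ q - ρ p) ^ 3 with hhdef
  have hhs : ContDiffAt ℝ ∞ h p := (hρ.sub contDiffAt_const).pow 3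
  have hh₀ : h p = 0 := by simp [h]
  have hht : timeDeriv h p = 0 := (hasDerivAt_sub_pow_three hρ.comp_time).deriv
  have hhx : spaceDeriv h p = 0 := (hasDerivAt_sub_pow_three hρ.comp_space).deriv
  have hhx₃ : spaceDeriv₃ h p = 6 * (pdX T z + pdU T z * a) ^ 3 := by
    rw [← hρx]
    exact iteratedDeriv_three_sub_pow_three hρ.comp_space
  set v : ℝ × ℝ → ℝ := fun q => u q + h q with hvdef
  have hvs : ContDiffAt ℝ ∞ v p := hus.add hhs
  have hvz : graphPoint v p = z := by rw [← huz]; simp [graphPoint, v, hh₀]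
  have hvt : timeDeriv v p = τ := by rw [hvdef, timeDeriv_add hus hhs, hut, hht, add_zero]
  have hvx : spaceDeriv v p = a := by rw [hvdef, spaceDeriv_add hus hhs, hux, hhx, add_zero]
  obtain ⟨w, hw, hmap⟩ := exists_transformsAt hΦ hus huz hz (by rwa [hut, hux])
  obtain ⟨w', hw', -⟩ := exists_transformsAt hΦ hvs hvz hz (by rwa [hvt, hvx])
  have e1 := hw.time_eq hΦ huz
  have e2 := hw.space_eq hΦ huz
  have e1' := hw'.time_eq hΦ hvz
  have e2' := hw'.space_eq hΦ hvz
  rw [hut] at e1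
  rw [hux] at e2
  rw [hvt] at e1'
  rw [hvx] at e2'
  set y : ℝ × ℝ := (T z, X z) with hy
  have ht : timeDeriv w' y = timeDeriv w y := by
    refine sub_eq_zero.1 ((mul_eq_zero.1 ?_).resolve_left hΔ)
    linear_combination (e1' - e1) * (pdX X z + pdU X z * a)
      - (e2' - e2) * (pdT X z + pdU X z * τ)
  -- Where $T=T(z)$ on the graph of `u`, the perturbation vanishes; there the two graphs share a
  -- point and so do their images.
  have hev : ∀ᶠ y' in 𝓝 y, y'.1 = y.1 → w' y' = w y' := by
    rw [← hmap, eventually_map]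
    filter_upwards [hw.eventually_eq hΦ, hw'.eventually_eq hΦ] with q hq hq' hqT
    have hρp : ρ p = T z := by rw [hρdef]; simp only [huz]
    have hhq : h q = 0 := by
      have : ρ q = ρ p := by rw [hρp]; exact hqT
      simp [h, this]
    have hγ : graphPoint v q = graphPoint u q := by simp [graphPoint, v, hhq]
    rw [hγ] at hq'
    rw [hq', hq]
  have hline : (fun r => w' (y.1, r)) =ᶠ[𝓝 y.2] fun r => w (y.1, r) := by
    filter_upwards [(Continuous.prodMk_right y.1).continuousAt.eventually hev] with r hr
    exact hr rfl
  have hx : spaceDeriv w' y = spaceDeriv w y := hline.deriv_eq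
  have hx₃ : spaceDeriv₃ w' y = spaceDeriv₃ w y := hline.iteratedDeriv_eq 3
  have hyy : w' y = w y := hline.self_of_nhds
  have hbase : ∀ v', graphPoint v' p = z → basePoint (Φ (graphPoint v' p)) = y := fun v' hv' => by
    rw [hv', hΦ.eq]; rfl
  have hGw := (hm u w p hw).1 hGu
  rw [hbase u huz, gardnerAt_iff] at hGw
  have hGw' : GardnerAt k f g v p := (hm v w' p hw').2 (by
    rw [hbase v hvz, gardnerAt_iff, ht, hx, hx₃, hyy]
    exact hGw)
  have hfin := (gardnerAt_add_iff hus hhs hh₀ hhx hGu).1 hGw'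
  rw [hht, hhx₃, zero_add] at hfin
  have := (mul_eq_zero.1 hfin).resolve_left hg
  exact pow_eq_zero_iff (by norm_num) |>.1 ((mul_eq_zero.1 this).resolve_left (by norm_num))

/-- The new time variable depends on the old time variable only. -/
theorem MapsGardner.pdX_pdU_eq_zero (hΦ : IsComponents Φ T X U)
    (hm : MapsGardner Φ k f g (fun _ => k') (fun _ => f') (fun _ => g'))
    (hz : z ∈ Φ.source) (hg : g z.1 ≠ 0) : pdX T z = 0 ∧ pdU T z = 0 := by
  have key := fun τ a => hm.total_pdX_eq_zero hΦ hz hg (τ := τ) (a := a)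
  have hdet := hΦ.det_ne_zero z hz
  -- The transversality determinant is affine in `τ` and `a`, with coefficients `m₀`, `m₁`, `m₂`
  -- that cannot all vanish because they are minors of the Jacobian. Hence it is nonzero for two
  -- different slopes `a`, and $T_x+T_ua$ vanishes at both.
  set m₀ := pdT T z * pdX X z - pdX T z * pdT X z with hm₀
  set m₁ := pdU T z * pdX X z - pdX T z * pdU X z with hm₁
  set m₂ := pdT T z * pdU X z - pdU T z * pdT X z with hm₂
  have key' : ∀ τ a, m₀ + m₁ * τ + m₂ * a ≠ 0 → pdX T z + pdU T z * a = 0 := fun τ a h =>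
    key τ a (by convert h using 1; rw [hm₀, hm₁, hm₂]; ring)
  by_cases h1 : m₁ = 0
  · by_cases h2 : m₂ = 0
    · have h0 : m₀ ≠ 0 := fun h0 => hdet (by
        linear_combination pdU U z * h0 - pdX U z * h2 - pdT U z * h1)
      have a0 := key' 0 0 (by simpa using h0)
      have a1 := key' 0 1 (by simpa [h2] using h0)
      constructor <;> linarith
    · have a1 := key' 0 ((1 - m₀) / m₂) (by field_simp; simp)
      have a2 := key' 0 ((2 - m₀) / m₂) (by field_simp; simp)
      have : pdU T z = 0 := by
        field_simp at a1 a2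
        linarith
      refine ⟨?_, this⟩
      rwa [this, zero_mul, add_zero] at a1
  · have a0 := key' ((1 - m₀) / m₁) 0 (by field_simp; simp)
    have a1 := key' ((1 - m₀ - m₂) / m₁) 1 (by field_simp; ring_nf; simp)
    constructor <;> linarith

/-- The dependence of the transformed function on the function, to leading order. -/
theorem TransformsAt.sub_isLittleO (hΦ : IsComponents Φ T X U) {u h w w' : ℝ × ℝ → ℝ}
    {p : ℝ × ℝ} (hw : TransformsAt Φ u w p) (hw' : TransformsAt Φ (fun q => u q + h q) w' p)
    (hz : graphPoint u p = z) (h₀ : h p = 0) :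
    ∃ Θ : ℝ, (fun q => w' (T (graphPoint u q), X (graphPoint u q))
      - w (T (graphPoint u q), X (graphPoint u q)) - Θ * h q) =o[𝓝 p] h := by
  set v : ℝ × ℝ → ℝ := fun q => u q + h q with hvdef
  have hvz : graphPoint v p = z := by rw [← hz]; simp [graphPoint, v, h₀]
  have hzs : z ∈ Φ.source := hz ▸ hw.mem_source
  have hTs := contDiffAt_of_mem_source hΦ.smooth_T hzs
  have hXs := contDiffAt_of_mem_source hΦ.smooth_X hzs
  have hUs := contDiffAt_of_mem_source hΦ.smooth_U hzs
  have hws : ContDiffAt ℝ ∞ w' (T z, X z) := by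
    have := hw'.contDiffAt_right hΦ
    rwa [hvz] at this
  -- `M` vanishes on the graph of `v`, while on the graph of `u` it equals the old transformed
  -- function minus the new one. The two graphs differ by `h` in the direction of $u$, so
  -- $\Theta=M_u$; strict differentiability is needed because both points move.
  set M : ℝ × ℝ × ℝ → ℝ := fun z => U z - w' (T z, X z) with hM
  have hMs : ContDiffAt ℝ ∞ M z := hUs.sub (ContDiffAt.comp z hws (hTs.prodMk hXs))
  refine ⟨pdU M z, ?_⟩
  have hstrict := (hMs.hasStrictFDerivAt (by simp)).isLittleO
  have hcu : Tendsto (graphPoint u) (𝓝 p) (𝓝 z) := by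
    rw [← hz]
    exact (continuousAt_fst.prodMk (continuousAt_snd.prodMk hw.smooth_left.continuousAt)).tendsto
  have hcv : Tendsto (graphPoint v) (𝓝 p) (𝓝 z) := by
    rw [← hvz]
    exact (continuousAt_fst.prodMk (continuousAt_snd.prodMk hw'.smooth_left.continuousAt)).tendsto
  have ho := hstrict.comp_tendsto (hcv.prodMk_nhds hcu)
  have hdiff : ∀ q, graphPoint v q - graphPoint u q = h q • ((0 : ℝ), (0 : ℝ), (1 : ℝ)) :=
    fun q => by simp [graphPoint, v]
  refine (ho.congr' ?_ (EventuallyEq.rfl)).trans_isBigO ?_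
  · filter_upwards [hw.eventually_eq hΦ, hw'.eventually_eq hΦ] with q hq hq'
    simp only [Function.comp_apply, hdiff, map_smul, smul_eq_mul]
    have e1 : M (graphPoint v q) = 0 := sub_eq_zero.2 hq'.symm
    rw [e1, hM]
    simp only [← hq]
    change _ - h q * pdU M z = _
    ring
  · refine Asymptotics.IsBigO.of_bound 1 (Eventually.of_forall fun q => ?_)
    simp only [Function.comp_apply, hdiff, norm_smul]
    simp

/-- If two smooth functions of `(t, x)` differ by a multiple of `l (t - t₀) + (x - x₀) ^ 3` to
leading order, then so do their jets. -/
theorem jet_sub_of_isLittleO {w w' : ℝ × ℝ → ℝ} {y : ℝ × ℝ} {Θ l : ℝ}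
    (hw : ContDiffAt ℝ ∞ w y) (hw' : ContDiffAt ℝ ∞ w' y) (h₀ : w' y = w y)
    (h : (fun q : ℝ × ℝ => w' q - w q - Θ * (l * (q.1 - y.1) + (q.2 - y.2) ^ 3)) =o[𝓝 y]
      fun q => l * (q.1 - y.1) + (q.2 - y.2) ^ 3) :
    timeDeriv w' y = timeDeriv w y + Θ * l ∧ spaceDeriv w' y = spaceDeriv w y ∧
      spaceDeriv₃ w' y = spaceDeriv₃ w y + 6 * Θ := by
  -- Restriction to the two coordinate lines through `y` leaves only the linear part, respectively
  -- only the cube.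
  have hT := h.comp_tendsto (k := fun s : ℝ => (s, y.2))
    (Continuous.prodMk_left y.2).continuousAt.tendsto
  have hX := h.comp_tendsto (k := fun r : ℝ => (y.1, r))
    (Continuous.prodMk_right y.1).continuousAt.tendsto
  simp only [Function.comp_def, sub_self, mul_zero, zero_add, ne_eq, OfNat.ofNat_ne_zero,
    not_false_eq_true, zero_pow, add_zero] at hT hX
  have hcube : ContDiffAt ℝ ∞ (fun r : ℝ => (r - y.2) ^ 3) y.2 := by fun_prop
  have hcube' := hasDerivAt_sub_pow_three (ρ := fun r => r) (x := y.2) contDiffAt_id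
  have hcube₃ := iteratedDeriv_three_sub_pow_three (ρ := fun r => r) (x := y.2) contDiffAt_id
  have hs : ContDiffAt ℝ ∞ (fun r => w' (y.1, r) - w (y.1, r) - Θ * (r - y.2) ^ 3) y.2 :=
    (hw'.comp_space.sub hw.comp_space).sub (contDiffAt_const.mul hcube)
  obtain ⟨j₁, j₃⟩ := jet_eq_zero_of_isLittleO hs hX
  refine ⟨?_, ?_, ?_⟩
  · have hd : HasDerivAt (fun s => w' (s, y.2) - w (s, y.2) - Θ * (l * (s - y.1))) 0 y.1 := by
      rw [hasDerivAt_iff_isLittleO]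
      refine (hT.trans_isBigO (Asymptotics.isBigO_const_mul_self l _ _)).congr_left fun s => ?_
      have : w' (y.1, y.2) = w (y.1, y.2) := h₀
      simp [this]
    have := hd.unique ((hw'.hasDerivAt_time.fun_sub hw.hasDerivAt_time).fun_sub
      ((((hasDerivAt_id y.1).sub_const y.1).const_mul l).const_mul Θ))
    linarith
  · have := ((hw'.hasDerivAt_space.fun_sub hw.hasDerivAt_space).fun_sub
      (hcube'.const_mul Θ)).deriv
    rw [j₁] at this
    linarith
  · rw [iteratedDeriv_fun_sub
      ((hw'.comp_space.sub hw.comp_space).of_le (by norm_cast))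
      ((contDiffAt_const.mul hcube).of_le (by norm_cast)),
      iteratedDeriv_fun_sub (hw'.comp_space.of_le (by norm_cast))
      (hw.comp_space.of_le (by norm_cast)), iteratedDeriv_const_mul_field, hcube₃] at j₃
    simp only [deriv_id'', one_pow, mul_one] at j₃
    simp only [spaceDeriv₃]
    linarith

/-- A perturbation $h=l(T-T_0)+(X-X_0)^3$ along the graph changes $\tilde u_{\tilde t}$ by $\Theta
l$ and $\tilde u_{\tilde x\tilde x\tilde x}$ by $6\Theta$, and keeps $\tilde u$ and $\tilde
u_{\tilde x}$. For $l=-6\tilde g$ the target equation is preserved, so the change $lT_t+6g(D_xX)^3$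
of (1) must vanish. -/
theorem MapsGardner.total_pdX_pow_three (hΦ : IsComponents Φ T X U)
    (hm : MapsGardner Φ k f g (fun _ => k') (fun _ => f') (fun _ => g'))
    (hTx : ∀ z ∈ Φ.source, pdX T z = 0 ∧ pdU T z = 0) (hz : z ∈ Φ.source) {a : ℝ}
    (ha : pdX X z + pdU X z * a ≠ 0) :
    g z.1 * (pdX X z + pdU X z * a) ^ 3 = g' * pdT T z := by
  have hdet := hΦ.det_ne_zero z hz
  obtain ⟨hTx0, hTu0⟩ := hTx z hz
  have hTt : pdT T z ≠ 0 := fun h0 => hdet (by rw [h0, hTx0, hTu0]; ring)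
  have hΔ : ∀ τ, (pdT T z + pdU T z * τ) * (pdX X z + pdU X z * a)
      - (pdX T z + pdU T z * a) * (pdT X z + pdU X z * τ) ≠ 0 := fun τ => by
    rw [hTx0, hTu0]
    simpa using ⟨hTt, ha⟩
  obtain ⟨t, x, c⟩ := z
  set p : ℝ × ℝ := (t, x) with hp
  set z : ℝ × ℝ × ℝ := (t, x, c) with hzdef
  set u := cubicJet p c (-(k p.1 * c + f p.1 * c ^ 2) * a) a 0 0 with hudef
  have hus : ContDiffAt ℝ ∞ u p := (contDiff_cubicJet ..).contDiffAt
  have huz : graphPoint u p = z := by simp [u, hp, hzdef]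
  have hux : spaceDeriv u p = a := by simp [u]
  have hGu : GardnerAt k f g u p := gardnerAt_cubicJet ..
  have hTs := contDiffAt_of_mem_source hΦ.smooth_T hz
  have hXs := contDiffAt_of_mem_source hΦ.smooth_X hz
  have hρ : ContDiffAt ℝ ∞ (fun q => T (graphPoint u q)) p :=
    contDiffAt_comp_graphPoint (huz ▸ hTs) hus
  have hξ : ContDiffAt ℝ ∞ (fun q => X (graphPoint u q)) p :=
    contDiffAt_comp_graphPoint (huz ▸ hXs) hus
  set ρ := fun q => T (graphPoint u q) with hρdef
  set ξ := fun q => X (graphPoint u q) with hξdef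
  have hρp : ρ p = T z := by rw [hρdef]; simp only [huz]
  have hξp : ξ p = X z := by rw [hξdef]; simp only [huz]
  have hρt : timeDeriv ρ p = pdT T z := by
    rw [hρdef, timeDeriv_comp_graphPoint (huz ▸ hTs) hus, huz, hTu0]; ring
  have hρx : spaceDeriv ρ p = 0 := by
    rw [hρdef, spaceDeriv_comp_graphPoint (huz ▸ hTs) hus, huz, hTx0, hTu0]; ring
  have hξx : spaceDeriv ξ p = pdX X z + pdU X z * a := by
    rw [hξdef, spaceDeriv_comp_graphPoint (huz ▸ hXs) hus, huz, hux]
  -- This needs $T_x=T_u=0$ on the whole curve near `p`, not only at `z`.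
  have hρx₃ : spaceDeriv₃ ρ p = 0 := by
    refine iteratedDeriv_three_of_hasDerivAt (η₁ := fun _ => 0) (η₂ := fun _ => 0) ?_
      (Eventually.of_forall fun y => hasDerivAt_const y 0) (hasDerivAt_const _ 0)
    have hmem : ∀ᶠ y in 𝓝 p.2, graphPoint u (p.1, y) ∈ Φ.source := by
      have hc : Continuous fun y => graphPoint u (p.1, y) := by
        have := (contDiff_cubicJet p c (-(k p.1 * c + f p.1 * c ^ 2) * a) a 0 0).continuous
        exact continuous_const.prodMk (continuous_id.prodMk
          (this.comp (Continuous.prodMk_right p.1)))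
      refine hc.continuousAt.eventually (Φ.open_source.mem_nhds ?_)
      change graphPoint u p ∈ Φ.source
      rwa [huz]
    filter_upwards [hmem] with y hy
    refine (hasDerivAt_graph_space (F := T)
      ((contDiffAt_of_mem_source hΦ.smooth_T hy).differentiableAt (by simp))
      (hasDerivAt_cubicJet_space p c _ a 0 0 y)).congr_deriv ?_
    have h1 := (hTx _ hy).1
    have h2 := (hTx _ hy).2
    simp only [graphPoint] at h1 h2
    rw [h1, h2]; ring
  set l : ℝ := -6 * g' with hl
  set h : ℝ × ℝ → ℝ := fun q => l * (ρ q - ρ p) + (ξ q - ξ p) ^ 3 with hhdef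
  have ha₁ : ContDiffAt ℝ ∞ (fun q => l * (ρ q - ρ p)) p :=
    contDiffAt_const.mul (hρ.sub contDiffAt_const)
  have ha₂ : ContDiffAt ℝ ∞ (fun q => (ξ q - ξ p) ^ 3) p := (hξ.sub contDiffAt_const).pow 3
  have hhs : ContDiffAt ℝ ∞ h p := ha₁.add ha₂
  have hh₀ : h p = 0 := by simp [h]
  have hht : timeDeriv h p = l * pdT T z := by
    rw [hhdef, timeDeriv_add ha₁ ha₂, ← hρt]
    have e1 : timeDeriv (fun q => l * (ρ q - ρ p)) p = l * timeDeriv ρ p :=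
      ((hρ.hasDerivAt_time.sub_const (ρ p)).const_mul l).deriv
    have e2 : timeDeriv (fun q => (ξ q - ξ p) ^ 3) p = 0 :=
      (hasDerivAt_sub_pow_three hξ.comp_time).deriv
    rw [e1, e2, add_zero]
  have hhx : spaceDeriv h p = 0 := by
    rw [hhdef, spaceDeriv_add ha₁ ha₂]
    have e1 : spaceDeriv (fun q => l * (ρ q - ρ p)) p = l * spaceDeriv ρ p :=
      ((hρ.hasDerivAt_space.sub_const (ρ p)).const_mul l).deriv
    have e2 : spaceDeriv (fun q => (ξ q - ξ p) ^ 3) p = 0 :=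
      (hasDerivAt_sub_pow_three hξ.comp_space).deriv
    rw [e1, e2, hρx, mul_zero, add_zero]
  have hhx₃ : spaceDeriv₃ h p = 6 * (pdX X z + pdU X z * a) ^ 3 := by
    rw [hhdef, spaceDeriv₃_add ha₁ ha₂, ← hξx]
    have e1 : spaceDeriv₃ (fun q => l * (ρ q - ρ p)) p = l * spaceDeriv₃ ρ p := by
      simp only [spaceDeriv₃, iteratedDeriv_const_mul_field]
      rw [iteratedDeriv_fun_sub (hρ.comp_space.of_le (by norm_cast)) contDiffAt_const]
      simp [iteratedDeriv_const]
    have e2 : spaceDeriv₃ (fun q => (ξ q - ξ p) ^ 3) p = 6 * spaceDeriv ξ p ^ 3 :=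
      iteratedDeriv_three_sub_pow_three hξ.comp_space
    rw [e1, e2, hρx₃, mul_zero, zero_add]
  set v : ℝ × ℝ → ℝ := fun q => u q + h q with hvdef
  have hvs : ContDiffAt ℝ ∞ v p := hus.add hhs
  have hvz : graphPoint v p = z := by rw [← huz]; simp [graphPoint, v, hh₀]
  have hvx : spaceDeriv v p = a := by rw [hvdef, spaceDeriv_add hus hhs, hux, hhx, add_zero]
  obtain ⟨w, hw, hmap⟩ := exists_transformsAt hΦ hus huz hz (by rw [hux]; exact hΔ _)
  obtain ⟨w', hw', -⟩ := exists_transformsAt hΦ hvs hvz hz (by rw [hvx]; exact hΔ _)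
  obtain ⟨Θ, hΘ⟩ := hw.sub_isLittleO hΦ hw' huz hh₀
  set y : ℝ × ℝ := (T z, X z) with hy
  have hws : ContDiffAt ℝ ∞ w y := by
    have := hw.contDiffAt_right hΦ
    rwa [huz] at this
  have hws' : ContDiffAt ℝ ∞ w' y := by
    have := hw'.contDiffAt_right hΦ
    rwa [hvz] at this
  have hyy : w' y = w y := by
    have h1 := (hw.eventually_eq hΦ).self_of_nhds
    have h2 := (hw'.eventually_eq hΦ).self_of_nhds
    rw [huz] at h1
    rw [hvz] at h2
    rw [hy, h1, h2]
  obtain ⟨jt, jx, jx₃⟩ := jet_sub_of_isLittleO (Θ := Θ) (l := l) hws hws' hyy (by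
    rw [← hmap, Asymptotics.isLittleO_map]
    rw [hhdef, hρp, hξp] at hΘ
    exact hΘ)
  have hbase : ∀ v', graphPoint v' p = z → basePoint (Φ (graphPoint v' p)) = y := fun v' hv' => by
    rw [hv', hΦ.eq]; rfl
  have hGw := (hm u w p hw).1 hGu
  rw [hbase u huz, gardnerAt_iff] at hGw
  have hGw' : GardnerAt k f g v p := (hm v w' p hw').2 (by
    rw [hbase v hvz, gardnerAt_iff, jt, jx, jx₃, hyy]
    linear_combination hGw + Θ * hl)
  have hfin := (gardnerAt_add_iff hus hhs hh₀ hhx hGu).1 hGw'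
  rw [hht, hhx₃, hl] at hfin
  change g p.1 * _ = _
  linarith

/-- The new space variable depends on the old time and space variables only, and is affine in the
space variable. -/
theorem MapsGardner.pdU_eq_zero_and_pow_three (hΦ : IsComponents Φ T X U)
    (hm : MapsGardner Φ k f g (fun _ => k') (fun _ => f') (fun _ => g'))
    (hTx : ∀ z ∈ Φ.source, pdX T z = 0 ∧ pdU T z = 0) (hz : z ∈ Φ.source) (hg : g z.1 ≠ 0) :
    pdU X z = 0 ∧ g z.1 * pdX X z ^ 3 = g' * pdT T z := by
  have key := fun a => hm.total_pdX_pow_three hΦ hTx hz (a := a)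
  have hXu : pdU X z = 0 := by
    by_contra hne
    -- If $X_u\ne0$, there are slopes with $D_xX=1$ and $D_xX=2$; the cubes differ by 7 while the
    -- right side is the same.
    have h1 := key ((1 - pdX X z) / pdU X z) (by field_simp; simp)
    have h2 := key ((2 - pdX X z) / pdU X z) (by field_simp; simp)
    rw [mul_div_cancel₀ _ hne] at h1 h2
    apply hg
    linear_combination (h2 - h1) / 7
  refine ⟨hXu, ?_⟩
  have := key 0 (by
    intro h0
    apply hΦ.det_ne_zero z hz
    rw [hXu, (hTx z hz).1, (hTx z hz).2]
    have : pdX X z = 0 := by simpa using h0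
    rw [this]
    ring)
  simpa using this

end Perturbation

/-! ### Third-order chain rule and the determining equations -/

section DeterminingEquations

theorem ContDiffAt.spaceDeriv {w : ℝ × ℝ → ℝ} {y : ℝ × ℝ} (hw : ContDiffAt ℝ ∞ w y) :
    ContDiffAt ℝ ∞ (spaceDeriv w) y := by
  have h1 : ContDiffAt ℝ ∞ (fun q => fderiv ℝ w q (0, 1)) y :=
    (hw.fderiv_right (by simp)).clm_apply contDiffAt_const
  refine h1.congr_of_eventuallyEq ?_
  have h2 : ContDiffAt ℝ 1 w y := hw.of_le (by simp)
  filter_upwards [h2.eventually (by simp)] with q hq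
  rw [fderiv_apply_eq_of_differentiableAt (hq.differentiableAt (by simp))]
  simp

theorem ContDiffAt.eventually_differentiableAt {w : ℝ × ℝ → ℝ} {y : ℝ × ℝ}
    (hw : ContDiffAt ℝ ∞ w y) : ∀ᶠ q in 𝓝 y, DifferentiableAt ℝ w q := by
  have h2 : ContDiffAt ℝ 1 w y := hw.of_le (by simp)
  filter_upwards [h2.eventually (by simp)] with q hq using hq.differentiableAt (by simp)

variable {Φ : OpenPartialHomeomorph (ℝ × ℝ × ℝ) (ℝ × ℝ × ℝ)} {T X U : ℝ × ℝ × ℝ → ℝ}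
  {k f g : ℝ → ℝ} {k' f' g' : ℝ}

/-- The value at `z` of the third total derivative of `U` with respect to `x` along a function
with first three derivatives `a`, `b`, `0`. -/
noncomputable def totalDeriv₃ (U : ℝ × ℝ × ℝ → ℝ) (a b : ℝ) (z : ℝ × ℝ × ℝ) : ℝ :=
  pdX (pdX (pdX U)) z
    + (pdU (pdX (pdX U)) z + pdX (pdU (pdX U)) z + pdX (pdX (pdU U)) z) * a
    + (pdU (pdU (pdX U)) z + pdU (pdX (pdU U)) z + pdX (pdU (pdU U)) z) * a ^ 2
    + pdU (pdU (pdU U)) z * a ^ 3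
    + (pdU (pdX U) z + 2 * pdX (pdU U) z + 3 * pdU (pdU U) z * a) * b

theorem spaceDeriv₃_comp_cubicJet {D : Set (ℝ × ℝ × ℝ)} (hD : IsOpen D)
    (hU : ContDiffOn ℝ ∞ U D) {p : ℝ × ℝ} {c τ a b : ℝ} (hz : (p.1, p.2, c) ∈ D) :
    spaceDeriv₃ (fun q => U (graphPoint (cubicJet p c τ a b 0) q)) p
      = totalDeriv₃ U a b (p.1, p.2, c) := by
  set ν : ℝ → ℝ := fun y => cubicJet p c τ a b 0 (p.1, y) with hν
  set n : ℝ → ℝ := fun y => a + b * (y - p.2) with hn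
  have hνd : ∀ y, HasDerivAt ν (n y) y := fun y =>
    (hasDerivAt_cubicJet_space p c τ a b 0 y).congr_deriv (by simp [hn])
  have hnd : ∀ y, HasDerivAt n b y := fun y =>
    ((((hasDerivAt_id y).sub_const p.2).const_mul b).const_add a).congr_deriv (by simp)
  have hν0 : ν p.2 = c := by simp [hν]
  have hn0 : n p.2 = a := by simp [hn]
  have hmem : ∀ᶠ y in 𝓝 p.2, (p.1, y, ν y) ∈ D := by
    have hc : ContinuousAt (fun y => (p.1, y, ν y)) p.2 :=
      continuousAt_const.prodMk (continuousAt_id.prodMk (hνd p.2).continuousAt)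
    exact hc.eventually (hD.mem_nhds (by simpa only [hν0] using hz))
  have step : ∀ F : ℝ × ℝ × ℝ → ℝ, ContDiffOn ℝ ∞ F D → ∀ y, (p.1, y, ν y) ∈ D →
      HasDerivAt (fun y => F (p.1, y, ν y))
        (pdX F (p.1, y, ν y) + pdU F (p.1, y, ν y) * n y) y := fun F hF y hy =>
    hasDerivAt_graph_space (hF.differentiableAt_of_isOpen hD hy) (hνd y)
  have hA := hU.dirDeriv hD (0, 1, 0)
  have hB := hU.dirDeriv hD (0, 0, 1)
  have hAx := hA.dirDeriv hD (0, 1, 0)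
  have hAu := hA.dirDeriv hD (0, 0, 1)
  have hBx := hB.dirDeriv hD (0, 1, 0)
  have hBu := hB.dirDeriv hD (0, 0, 1)
  refine iteratedDeriv_three_of_hasDerivAt
    (η₁ := fun y => pdX U (p.1, y, ν y) + pdU U (p.1, y, ν y) * n y)
    (η₂ := fun y => (pdX (pdX U) (p.1, y, ν y) + pdU (pdX U) (p.1, y, ν y) * n y)
      + ((pdX (pdU U) (p.1, y, ν y) + pdU (pdU U) (p.1, y, ν y) * n y) * n y
        + pdU U (p.1, y, ν y) * b)) ?_ ?_ ?_
  · filter_upwards [hmem] with y hy using step U hU y hy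
  · filter_upwards [hmem] with y hy
    exact (step _ hA y hy).fun_add ((step _ hB y hy).fun_mul (hnd y))
  · have hy := hmem.self_of_nhds
    refine (((step _ hAx _ hy).fun_add ((step _ hAu _ hy).fun_mul (hnd _))).fun_add
      ((((step _ hBx _ hy).fun_add ((step _ hBu _ hy).fun_mul (hnd _))).fun_mul (hnd _)).fun_add
        ((step _ hB _ hy).mul_const b))).congr_deriv ?_
    rw [hν0, hn0, totalDeriv₃]
    ring

/-- Along the graph in the direction of `x`, $T$ is constant and $X$ has constant derivative, so
each differentiation of $w(T,X)$ only contributes a factor $X_x$. -/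
theorem TransformsAt.space₃_eq (hΦ : IsComponents Φ T X U)
    (hTx : ∀ z ∈ Φ.source, pdX T z = 0 ∧ pdU T z = 0) (hXu : ∀ z ∈ Φ.source, pdU X z = 0)
    (hXxx : ∀ z ∈ Φ.source, pdX (pdX X) z = 0) {p : ℝ × ℝ} {c τ a b : ℝ} {w : ℝ × ℝ → ℝ}
    (h : TransformsAt Φ (cubicJet p c τ a b 0) w p) {z : ℝ × ℝ × ℝ} (hz : z = (p.1, p.2, c)) :
    spaceDeriv₃ w (T z, X z) * pdX X z ^ 3 = totalDeriv₃ U a b z := by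
  subst hz
  have hm : (p.1, p.2, c) ∈ Φ.source := by simpa using h.mem_source
  rw [← spaceDeriv₃_comp_cubicJet (τ := τ) Φ.open_source hΦ.smooth_U hm]
  set ν : ℝ → ℝ := fun y => cubicJet p c τ a b 0 (p.1, y) with hν
  have hνd : ∀ y, HasDerivAt ν (a + b * (y - p.2)) y := fun y =>
    (hasDerivAt_cubicJet_space p c τ a b 0 y).congr_deriv (by simp)
  have hν0 : ν p.2 = c := by simp [hν]
  have hc : ContinuousAt (fun y => (p.1, y, ν y)) p.2 :=
    continuousAt_const.prodMk (continuousAt_id.prodMk (hνd p.2).continuousAt)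
  have hmem : ∀ᶠ y in 𝓝 p.2, (p.1, y, ν y) ∈ Φ.source :=
    hc.eventually (Φ.open_source.mem_nhds (by simpa only [hν0] using hm))
  have hTd : ∀ y, (p.1, y, ν y) ∈ Φ.source → HasDerivAt (fun y => T (p.1, y, ν y)) 0 y :=
    fun y hy => (hasDerivAt_graph_space (hΦ.smooth_T.differentiableAt_of_isOpen Φ.open_source hy)
      (hνd y)).congr_deriv (by rw [(hTx _ hy).1, (hTx _ hy).2]; ring)
  have hXd : ∀ y, (p.1, y, ν y) ∈ Φ.source →
      HasDerivAt (fun y => X (p.1, y, ν y)) (pdX X (p.1, y, ν y)) y :=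
    fun y hy => (hasDerivAt_graph_space (hΦ.smooth_X.differentiableAt_of_isOpen Φ.open_source hy)
      (hνd y)).congr_deriv (by rw [hXu _ hy]; ring)
  have hα := hΦ.smooth_X.dirDeriv Φ.open_source (0, 1, 0)
  have hαd : ∀ y, (p.1, y, ν y) ∈ Φ.source → HasDerivAt (fun y => pdX X (p.1, y, ν y)) 0 y := by
    intro y hy
    refine (hasDerivAt_graph_space (hα.differentiableAt_of_isOpen Φ.open_source hy)
      (hνd y)).congr_deriv ?_
    have : pdU (pdX X) (p.1, y, ν y) = 0 :=
      (dirDeriv_comm Φ.open_source hΦ.smooth_X hy).trans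
        (dirDeriv_eq_zero_of_eqOn Φ.open_source hXu hy)
    rw [hXxx _ hy, this]
    ring
  set y₀ : ℝ × ℝ := (T (p.1, p.2, c), X (p.1, p.2, c)) with hy₀
  have hw : ContDiffAt ℝ ∞ w y₀ := by
    have := h.contDiffAt_right hΦ
    rwa [graphPoint_cubicJet] at this
  have hm' := hmem.self_of_nhds
  have hlim : Tendsto (fun y => (T (p.1, y, ν y), X (p.1, y, ν y))) (𝓝 p.2) (𝓝 y₀) := by
    have := ((hTd _ hm').continuousAt.prodMk (hXd _ hm').continuousAt).tendsto
    rwa [hν0] at this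
  have step : ∀ W : ℝ × ℝ → ℝ, ∀ y, (p.1, y, ν y) ∈ Φ.source →
      DifferentiableAt ℝ W (T (p.1, y, ν y), X (p.1, y, ν y)) →
      HasDerivAt (fun y => W (T (p.1, y, ν y), X (p.1, y, ν y)))
        (spaceDeriv W (T (p.1, y, ν y), X (p.1, y, ν y)) * pdX X (p.1, y, ν y)) y :=
    fun W y hy hW => (hasDerivAt_comp_pair (ρ := fun y => T (p.1, y, ν y))
      (σ := fun y => X (p.1, y, ν y)) hW (hTd y hy) (hXd y hy)).congr_deriv (by ring)
  have hev : (fun y => w (T (p.1, y, ν y), X (p.1, y, ν y))) =ᶠ[𝓝 p.2]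
      fun y => U (p.1, y, ν y) :=
    (Continuous.prodMk_right p.1).continuousAt.eventually (h.eventually_eq hΦ)
  refine Eq.trans (Eq.symm ?_) (hev.iteratedDeriv_eq (𝕜 := ℝ) 3)
  have d₀ := hlim.eventually hw.eventually_differentiableAt
  have d₁ := hlim.eventually hw.spaceDeriv.eventually_differentiableAt
  have d₂ := (hlim.eventually hw.spaceDeriv.spaceDeriv.eventually_differentiableAt).self_of_nhds
  refine iteratedDeriv_three_of_hasDerivAt
    (η₁ := fun y => spaceDeriv w (T (p.1, y, ν y), X (p.1, y, ν y)) * pdX X (p.1, y, ν y))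
    (η₂ := fun y => spaceDeriv (spaceDeriv w) (T (p.1, y, ν y), X (p.1, y, ν y))
      * pdX X (p.1, y, ν y) ^ 2) ?_ ?_ ?_
  · filter_upwards [hmem, d₀] with y hy hd using step w y hy hd
  · filter_upwards [hmem, d₁] with y hy hd
    exact ((step _ y hy hd).fun_mul (hαd y hy)).congr_deriv (by ring)
  · refine ((step _ _ hm' d₂).fun_mul ((hαd _ hm').fun_pow 2)).congr_deriv ?_
    rw [hν0]
    have : spaceDeriv₃ w y₀ = spaceDeriv (spaceDeriv (spaceDeriv w)) y₀ := by
      simp only [spaceDeriv₃]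
      rw [iteratedDeriv_succ', iteratedDeriv_succ', iteratedDeriv_one]
      rfl
    rw [this]
    ring

/-- The determining equations, before splitting with respect to the derivatives of `u`. -/
theorem MapsGardner.determining_eq (hΦ : IsComponents Φ T X U)
    (hm : MapsGardner Φ k f g (fun _ => k') (fun _ => f') (fun _ => g'))
    (hTx : ∀ z ∈ Φ.source, pdX T z = 0 ∧ pdU T z = 0) (hXu : ∀ z ∈ Φ.source, pdU X z = 0)
    (hXxx : ∀ z ∈ Φ.source, pdX (pdX X) z = 0)
    (hg : ∀ z ∈ Φ.source, g z.1 * pdX X z ^ 3 = g' * pdT T z)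
    {z : ℝ × ℝ × ℝ} (hz : z ∈ Φ.source) (a b : ℝ) :
    pdX X z * (pdT U z - pdU U z * ((k z.1 * z.2.2 + f z.1 * z.2.2 ^ 2) * a))
      + (pdT T z * (k' * U z + f' * U z ^ 2) - pdT X z) * (pdX U z + pdU U z * a)
      + pdX X z * g z.1 * totalDeriv₃ U a b z = 0 := by
  have hdet := hΦ.det_ne_zero z hz
  have hT0 := hTx z hz
  have hX0 := hXu z hz
  have hg0 := hg z hz
  obtain ⟨t, x, c⟩ := z
  set p : ℝ × ℝ := (t, x) with hp
  set z : ℝ × ℝ × ℝ := (t, x, c) with hzdef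
  set τ := -(k p.1 * c + f p.1 * c ^ 2) * a with hτ
  have hus : ContDiffAt ℝ ∞ (cubicJet p c τ a b 0) p := (contDiff_cubicJet ..).contDiffAt
  have huz : graphPoint (cubicJet p c τ a b 0) p = z := graphPoint_cubicJet ..
  have hGu : GardnerAt k f g (cubicJet p c τ a b 0) p := gardnerAt_cubicJet ..
  -- Here the transversality determinant is $T_tX_x$, a factor of the Jacobian determinant.
  obtain ⟨w, hw, -⟩ := exists_transformsAt hΦ hus huz hz (by
    intro h0
    apply hdet
    rw [hT0.1, hT0.2, hX0] at h0 ⊢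
    linear_combination pdU U z * h0)
  have e1 := hw.time_eq hΦ huz
  have e2 := hw.space_eq hΦ huz
  have e3 := hw.space₃_eq hΦ hTx hXu hXxx (z := z) rfl
  have e0 := (hw.eventually_eq hΦ).self_of_nhds
  have hGw := (hm _ w p hw).1 hGu
  have hbase : basePoint (Φ (graphPoint (cubicJet p c τ a b 0) p)) = (T z, X z) := by
    rw [huz, hΦ.eq]; rfl
  rw [hbase, gardnerAt_iff] at hGw
  rw [huz] at e0
  rw [timeDeriv_cubicJet, hT0.2, hX0] at e1
  rw [spaceDeriv_cubicJet, hT0.1, hT0.2, hX0] at e2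
  rw [e0] at hGw
  have hzz : z.1 = t := rfl
  have hzc : z.2.2 = c := rfl
  have hpt : p.1 = t := rfl
  rw [← e3, hzz, hzc]
  rw [hzz] at hg0
  rw [hpt] at hτ
  set wt := timeDeriv w (T z, X z)
  set wx := spaceDeriv w (T z, X z)
  set wxxx := spaceDeriv₃ w (T z, X z)
  -- The target equation, multiplied by $X_xT_t$, is cleared of $w_{\tilde t}$ by `e1`, of
  -- $w_{\tilde x}$ by `e2`, and of $\tilde g$ by `hg0`.
  linear_combination pdX X z * pdT T z * hGw - pdX X z * e1
    - (pdT T z * (k' * U z + f' * U z ^ 2) - pdT X z) * e2 + pdX X z * wxxx * hg0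
    - pdX X z * pdU U z * hτ

end DeterminingEquations

/-! ### Necessity: normal form of the transformation -/

section Necessity

variable {F : ℝ × ℝ × ℝ → ℝ} {t x c : ℝ}

theorem hasDerivAt_pdT (hF : DifferentiableAt ℝ F (t, x, c)) :
    HasDerivAt (fun s => F (s, x, c)) (pdT F (t, x, c)) t :=
  (hasDerivAt_graph_time hF (hasDerivAt_const t c)).congr_deriv (by ring)

theorem hasDerivAt_pdX (hF : DifferentiableAt ℝ F (t, x, c)) :
    HasDerivAt (fun y => F (t, y, c)) (pdX F (t, x, c)) x :=
  (hasDerivAt_graph_space hF (hasDerivAt_const x c)).congr_deriv (by ring)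

theorem hasDerivAt_pdU (hF : DifferentiableAt ℝ F (t, x, c)) :
    HasDerivAt (fun r => F (t, x, r)) (pdU F (t, x, c)) c := by
  refine (hF.hasFDerivAt.comp_hasDerivAt c
    ((hasDerivAt_const c t).prodMk ((hasDerivAt_const c x).prodMk (hasDerivAt_id c))))

theorem HasDerivAt.eq_of_eventuallyEq {φ ψ : ℝ → ℝ} {a b s : ℝ} (hφ : HasDerivAt φ a s)
    (hψ : HasDerivAt ψ b s) (h : ∀ᶠ r in 𝓝 s, φ r = ψ r) : a = b :=
  hφ.unique (hψ.congr_of_eventuallyEq h)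

variable {D : Set (ℝ × ℝ × ℝ)}

theorem eventually_mem_T (hD : IsOpen D) (h : (t, x, c) ∈ D) : ∀ᶠ s in 𝓝 t, (s, x, c) ∈ D :=
  (Continuous.prodMk_left (x, c)).continuousAt.eventually (hD.mem_nhds h)

theorem eventually_mem_X (hD : IsOpen D) (h : (t, x, c) ∈ D) : ∀ᶠ y in 𝓝 x, (t, y, c) ∈ D :=
  ((by fun_prop : Continuous fun y : ℝ => (t, y, c))).continuousAt.eventually (hD.mem_nhds h)

theorem eventually_mem_U (hD : IsOpen D) (h : (t, x, c) ∈ D) : ∀ᶠ r in 𝓝 c, (t, x, r) ∈ D :=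
  ((by fun_prop : Continuous fun r : ℝ => (t, x, r))).continuousAt.eventually (hD.mem_nhds h)

variable {Φ : OpenPartialHomeomorph (ℝ × ℝ × ℝ) (ℝ × ℝ × ℝ)} {T X U : ℝ × ℝ × ℝ → ℝ}
  {k f g : ℝ → ℝ} {k' f' g' : ℝ}

/-- Since $T_t$ does not depend on $x$, differentiating $gX_x^3=\tilde gT_t$ in $x$ gives
$3gX_x^2X_{xx}=0$. -/
theorem pdX_pdX_eq_zero (hΦ : IsComponents Φ T X U)
    (hTx : ∀ z ∈ Φ.source, pdX T z = 0 ∧ pdU T z = 0)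
    (hg : ∀ z ∈ Φ.source, g z.1 * pdX X z ^ 3 = g' * pdT T z)
    (hg0 : ∀ z ∈ Φ.source, g z.1 ≠ 0) (hX0 : ∀ z ∈ Φ.source, pdX X z ≠ 0)
    {z : ℝ × ℝ × ℝ} (hz : z ∈ Φ.source) : pdX (pdX X) z = 0 := by
  have hD := Φ.open_source
  have hXT : pdX (pdT T) z = 0 := (dirDeriv_comm hD hΦ.smooth_T hz).trans
    (dirDeriv_eq_zero_of_eqOn hD (fun z hz => (hTx z hz).1) hz)
  obtain ⟨t, x, c⟩ := z
  have h1 := hasDerivAt_pdX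
    ((hΦ.smooth_X.dirDeriv hD (0, 1, 0)).differentiableAt_of_isOpen hD hz)
  have h2 := hasDerivAt_pdX
    ((hΦ.smooth_T.dirDeriv hD (1, 0, 0)).differentiableAt_of_isOpen hD hz)
  have := ((h1.fun_pow 3).const_mul (g t)).eq_of_eventuallyEq (h2.const_mul g')
    ((eventually_mem_X hD hz).mono fun y hy => hg _ hy)
  change g t * (((3 : ℕ) : ℝ) * pdX X (t, x, c) ^ (3 - 1) * pdX (pdX X) (t, x, c))
    = g' * pdX (pdT T) (t, x, c) at this
  rw [hXT, mul_zero] at this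
  have h3 := (mul_eq_zero.1 this).resolve_left (hg0 _ hz)
  refine (mul_eq_zero.1 h3).resolve_left ?_
  have := hX0 _ hz
  positivity

/-- The form of a point transformation that maps a Gardner equation to a Gardner equation with
constant coefficients, and the relations between the coefficients. -/
theorem MapsGardner.normal_form (hΦ : IsComponents Φ T X U)
    (hm : MapsGardner Φ k f g (fun _ => k') (fun _ => f') (fun _ => g'))
    (hfg : ∀ z ∈ Φ.source, f z.1 * g z.1 ≠ 0) {z : ℝ × ℝ × ℝ} (hz : z ∈ Φ.source) :
    (pdT U z = 0 ∧ pdT (pdU U) z = 0 ∧ pdT (pdX X) z = 0) ∧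
    pdT T z ≠ 0 ∧ pdX X z ≠ 0 ∧ pdU U z ≠ 0 ∧
    g z.1 * pdX X z ^ 3 = g' * pdT T z ∧ pdX X z * f z.1 = pdT T z * f' * pdU U z ^ 2 ∧
    pdX X z * (k z.1 + 2 * f z.1 * z.2.2) = pdT T z * (k' + 2 * f' * U z) * pdU U z := by
  have hD := Φ.open_source
  have hf0 : ∀ z ∈ Φ.source, f z.1 ≠ 0 := fun z hz => left_ne_zero_of_mul (hfg z hz)
  have hg0 : ∀ z ∈ Φ.source, g z.1 ≠ 0 := fun z hz => right_ne_zero_of_mul (hfg z hz)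
  have hTx : ∀ z ∈ Φ.source, pdX T z = 0 ∧ pdU T z = 0 := fun z hz =>
    hm.pdX_pdU_eq_zero hΦ hz (hg0 z hz)
  have hXu' := fun z hz => hm.pdU_eq_zero_and_pow_three hΦ hTx (z := z) hz (hg0 z hz)
  have hXu : ∀ z ∈ Φ.source, pdU X z = 0 := fun z hz => (hXu' z hz).1
  have hgX : ∀ z ∈ Φ.source, g z.1 * pdX X z ^ 3 = g' * pdT T z := fun z hz => (hXu' z hz).2
  have hdet : ∀ z ∈ Φ.source, pdT T z * (pdX X z * pdU U z) ≠ 0 := fun z hz => by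
    have := hΦ.det_ne_zero z hz
    rw [(hTx z hz).1, (hTx z hz).2, hXu z hz] at this
    convert this using 1
    ring
  have hT0 : ∀ z ∈ Φ.source, pdT T z ≠ 0 := fun z hz => left_ne_zero_of_mul (hdet z hz)
  have hX0 : ∀ z ∈ Φ.source, pdX X z ≠ 0 := fun z hz =>
    left_ne_zero_of_mul (right_ne_zero_of_mul (hdet z hz))
  have hU0 : ∀ z ∈ Φ.source, pdU U z ≠ 0 := fun z hz =>
    right_ne_zero_of_mul (right_ne_zero_of_mul (hdet z hz))
  have hXxx : ∀ z ∈ Φ.source, pdX (pdX X) z = 0 := fun z hz =>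
    pdX_pdX_eq_zero hΦ hTx hgX hg0 hX0 hz
  have key := fun z hz => hm.determining_eq hΦ hTx hXu hXxx hgX (z := z) hz
  -- splitting with respect to the second derivative
  have hsplit : ∀ z ∈ Φ.source, ∀ a,
      pdU (pdX U) z + 2 * pdX (pdU U) z + 3 * pdU (pdU U) z * a = 0 := fun z hz a => by
    have h0 := key z hz a 0
    have h1 := key z hz a 1
    refine (mul_eq_zero.1 ?_).resolve_left (mul_ne_zero (hX0 z hz) (hg0 z hz))
    simp only [totalDeriv₃] at h0 h1
    linear_combination h1 - h0
  have hBu : ∀ z ∈ Φ.source, pdU (pdU U) z = 0 := fun z hz => by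
    linarith [hsplit z hz 0, hsplit z hz 1]
  have hcomm : ∀ z ∈ Φ.source, pdX (pdU U) z = pdU (pdX U) z := fun z hz =>
    dirDeriv_comm hD hΦ.smooth_U hz
  have hBx : ∀ z ∈ Φ.source, pdX (pdU U) z = 0 := fun z hz => by
    linarith [hsplit z hz 0, hcomm z hz]
  have hAu : ∀ z ∈ Φ.source, pdU (pdX U) z = 0 := fun z hz => by
    linarith [hBx z hz, hcomm z hz]
  have hthird : ∀ z ∈ Φ.source, ∀ a, totalDeriv₃ U a 0 z = pdX (pdX (pdX U)) z := by
    intro z hz a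
    have e1 : pdU (pdX (pdX U)) z = 0 :=
      (dirDeriv_comm hD (hΦ.smooth_U.dirDeriv hD _) hz).trans (dirDeriv_eq_zero_of_eqOn hD hAu hz)
    have e2 : pdX (pdU (pdX U)) z = 0 := dirDeriv_eq_zero_of_eqOn hD hAu hz
    have e3 : pdX (pdX (pdU U)) z = 0 := dirDeriv_eq_zero_of_eqOn hD hBx hz
    have e4 : pdU (pdU (pdX U)) z = 0 := dirDeriv_eq_zero_of_eqOn hD hAu hz
    have e5 : pdU (pdX (pdU U)) z = 0 := dirDeriv_eq_zero_of_eqOn hD hBx hz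
    have e6 : pdX (pdU (pdU U)) z = 0 := dirDeriv_eq_zero_of_eqOn hD hBu hz
    have e7 : pdU (pdU (pdU U)) z = 0 := dirDeriv_eq_zero_of_eqOn hD hBu hz
    rw [totalDeriv₃, e1, e2, e3, e4, e5, e6, e7]
    ring
  -- splitting with respect to the first derivative
  have hP : ∀ z ∈ Φ.source, pdT T z * (k' * U z + f' * U z ^ 2) - pdT X z
      = pdX X z * (k z.1 * z.2.2 + f z.1 * z.2.2 ^ 2) := fun z hz => by
    have h0 := key z hz 0 0
    have h1 := key z hz 1 0
    rw [hthird z hz] at h0 h1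
    refine mul_left_cancel₀ (hU0 z hz) ?_
    linear_combination h1 - h0
  have hQ : ∀ z ∈ Φ.source, pdT U z + (k z.1 * z.2.2 + f z.1 * z.2.2 ^ 2) * pdX U z
      + g z.1 * pdX (pdX (pdX U)) z = 0 := fun z hz => by
    have h0 := key z hz 0 0
    rw [hthird z hz, hP z hz] at h0
    refine (mul_eq_zero.1 ?_).resolve_left (hX0 z hz)
    linear_combination h0
  have dd : ∀ F, ContDiffOn ℝ ∞ F Φ.source → ∀ z ∈ Φ.source, DifferentiableAt ℝ F z :=
    fun F hF z hz => hF.differentiableAt_of_isOpen hD hz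
  have hTt := hΦ.smooth_T.dirDeriv hD (1, 0, 0)
  have hXt := hΦ.smooth_X.dirDeriv hD (1, 0, 0)
  have hXx := hΦ.smooth_X.dirDeriv hD (0, 1, 0)
  have hUu := hΦ.smooth_U.dirDeriv hD (0, 0, 1)
  have zTu : ∀ z ∈ Φ.source, pdU (pdT T) z = 0 := fun z hz =>
    (dirDeriv_comm hD hΦ.smooth_T hz).trans
      (dirDeriv_eq_zero_of_eqOn hD (fun z hz => (hTx z hz).2) hz)
  have zTx : ∀ z ∈ Φ.source, pdX (pdT T) z = 0 := fun z hz =>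
    (dirDeriv_comm hD hΦ.smooth_T hz).trans
      (dirDeriv_eq_zero_of_eqOn hD (fun z hz => (hTx z hz).1) hz)
  have zXt : ∀ z ∈ Φ.source, pdU (pdT X) z = 0 := fun z hz =>
    (dirDeriv_comm hD hΦ.smooth_X hz).trans (dirDeriv_eq_zero_of_eqOn hD hXu hz)
  have zXx : ∀ z ∈ Φ.source, pdU (pdX X) z = 0 := fun z hz =>
    (dirDeriv_comm hD hΦ.smooth_X hz).trans (dirDeriv_eq_zero_of_eqOn hD hXu hz)
  -- `hP` is differentiated in $u$ here, and once more for `hP₂`; only $U$ and $u$ itself vary, and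
  -- $U_{uu}=0$.
  have hP₁ : ∀ z ∈ Φ.source, pdT T z * (k' + 2 * f' * U z) * pdU U z
      = pdX X z * (k z.1 + 2 * f z.1 * z.2.2) := by
    rintro ⟨t, x, c⟩ hz
    have a1 := (hasDerivAt_pdU (dd _ hTt _ hz)).congr_deriv (zTu _ hz)
    have a2 := (hasDerivAt_pdU (dd _ hXt _ hz)).congr_deriv (zXt _ hz)
    have a3 := (hasDerivAt_pdU (dd _ hXx _ hz)).congr_deriv (zXx _ hz)
    have a4 := hasDerivAt_pdU (dd _ hΦ.smooth_U _ hz)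
    have a5 := hasDerivAt_id c
    have := ((a1.fun_mul ((a4.const_mul k').fun_add ((a4.fun_pow 2).const_mul f'))).fun_sub
      a2).eq_of_eventuallyEq (a3.fun_mul ((a5.const_mul (k t)).fun_add
        ((a5.fun_pow 2).const_mul (f t))))
      ((eventually_mem_U hD hz).mono fun r hr => hP _ hr)
    push_cast at this
    simp only [id] at this
    linear_combination this
  have hP₂ : ∀ z ∈ Φ.source, pdX X z * f z.1 = pdT T z * f' * pdU U z ^ 2 := by
    rintro ⟨t, x, c⟩ hz
    have a1 := (hasDerivAt_pdU (dd _ hTt _ hz)).congr_deriv (zTu _ hz)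
    have a3 := (hasDerivAt_pdU (dd _ hXx _ hz)).congr_deriv (zXx _ hz)
    have a4 := hasDerivAt_pdU (dd _ hΦ.smooth_U _ hz)
    have a6 := (hasDerivAt_pdU (dd _ hUu _ hz)).congr_deriv (hBu _ hz)
    have a5 := hasDerivAt_id c
    have := ((a1.fun_mul ((a4.const_mul (2 * f')).const_add k')).fun_mul
      a6).eq_of_eventuallyEq (a3.fun_mul ((a5.const_mul (2 * f t)).const_add (k t)))
      ((eventually_mem_U hD hz).mono fun r hr => hP₁ _ hr)
    simp only [id] at this
    change pdX X (t, x, c) * f t = pdT T (t, x, c) * f' * pdU U (t, x, c) ^ 2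
    linear_combination -this / 2
  have hf' : f' ≠ 0 := by
    rintro rfl
    refine mul_ne_zero (hX0 z hz) (hf0 z hz) ?_
    rw [hP₂ z hz]
    ring
  -- In the $x$-derivative of `hP₁` only $U$ varies, which leaves $2\tilde fT_tU_uU_x=0$.
  have hA : ∀ z ∈ Φ.source, pdX U z = 0 := by
    rintro ⟨t, x, c⟩ hz
    have a1 := (hasDerivAt_pdX (dd _ hTt _ hz)).congr_deriv (zTx _ hz)
    have a3 := (hasDerivAt_pdX (dd _ hXx _ hz)).congr_deriv (hXxx _ hz)
    have a4 := hasDerivAt_pdX (dd _ hΦ.smooth_U _ hz)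
    have a6 := (hasDerivAt_pdX (dd _ hUu _ hz)).congr_deriv (hBx _ hz)
    have := ((a1.fun_mul ((a4.const_mul (2 * f')).const_add k')).fun_mul
      a6).eq_of_eventuallyEq (a3.mul_const (k t + 2 * f t * c))
      ((eventually_mem_X hD hz).mono fun r hr => hP₁ _ hr)
    refine (mul_eq_zero.1 ?_).resolve_left
      (mul_ne_zero (mul_ne_zero (hT0 _ hz) hf') (hU0 _ hz))
    linear_combination this / 2
  -- The $x$-derivative of `hP`: with $U_x=0$, the only remaining term is $X_{tx}$.
  have hXtx : ∀ z ∈ Φ.source, pdX (pdT X) z = 0 := by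
    rintro ⟨t, x, c⟩ hz
    have a1 := (hasDerivAt_pdX (dd _ hTt _ hz)).congr_deriv (zTx _ hz)
    have a2 := hasDerivAt_pdX (dd _ hXt _ hz)
    have a3 := (hasDerivAt_pdX (dd _ hXx _ hz)).congr_deriv (hXxx _ hz)
    have a4 := (hasDerivAt_pdX (dd _ hΦ.smooth_U _ hz)).congr_deriv (hA _ hz)
    have := ((a1.fun_mul ((a4.const_mul k').fun_add ((a4.fun_pow 2).const_mul f'))).fun_sub
      a2).eq_of_eventuallyEq (a3.mul_const (k t * c + f t * c ^ 2))
      ((eventually_mem_X hD hz).mono fun r hr => hP _ hr)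
    linear_combination -this
  have hUt : ∀ z ∈ Φ.source, pdT U z = 0 := fun z hz => by
    have e1 : pdX (pdX (pdX U)) z = 0 := dirDeriv_eq_zero_of_eqOn hD
      (fun z hz => dirDeriv_eq_zero_of_eqOn hD hA hz) hz
    have := hQ z hz
    rwa [e1, hA z hz, mul_zero, mul_zero, add_zero, add_zero] at this
  refine ⟨⟨hUt z hz, ?_, ?_⟩, hT0 z hz, hX0 z hz, hU0 z hz, hgX z hz, hP₂ z hz, (hP₁ z hz).symm⟩
  · exact (dirDeriv_comm hD hΦ.smooth_U hz).trans (dirDeriv_eq_zero_of_eqOn hD hUt hz)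
  · exact (dirDeriv_comm hD hΦ.smooth_X hz).trans (hXtx z hz)

/-- The relations of the normal form give $k/f=(\tilde k+2\tilde fU)/(\tilde fU_u)-2u$ and
$g/f=\tilde g/(\tilde fX_x^2U_u^2)$. For fixed $x$ and $u$ the right sides have zero $t$-derivative.
The argument is local in $D$, so $D$ need not be connected. -/
theorem ReducibleToConstant.hasDerivAt_div (h : ReducibleToConstant D k f g)
    (hfg : ∀ z ∈ D, f z.1 * g z.1 ≠ 0) {z : ℝ × ℝ × ℝ} (hz : z ∈ D) :
    HasDerivAt (fun s => k s / f s) 0 z.1 ∧ HasDerivAt (fun s => g s / f s) 0 z.1 := by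
  obtain ⟨Φ, hΦ, rfl, k', f', g', hc, hm⟩ := h
  have hD := Φ.open_source
  have hC := hΦ.isComponents
  set T : ℝ × ℝ × ℝ → ℝ := fun z => (Φ z).1
  set X : ℝ × ℝ × ℝ → ℝ := fun z => (Φ z).2.1
  set U : ℝ × ℝ × ℝ → ℝ := fun z => (Φ z).2.2
  have hf' : f' ≠ 0 := left_ne_zero_of_mul (hc.fg_ne_zero 0 trivial)
  have key := fun z hz => hm.normal_form hC hfg (z := z) hz
  obtain ⟨t, x, c⟩ := z
  obtain ⟨⟨u1, u2, u3⟩, -, v2, v3, -⟩ := key _ hz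
  have a1 := (hasDerivAt_pdT (hC.smooth_U.differentiableAt_of_isOpen hD hz)).congr_deriv u1
  have a2 := (hasDerivAt_pdT
    ((hC.smooth_U.dirDeriv hD (0, 0, 1)).differentiableAt_of_isOpen hD hz)).congr_deriv u2
  have a3 := (hasDerivAt_pdT
    ((hC.smooth_X.dirDeriv hD (0, 1, 0)).differentiableAt_of_isOpen hD hz)).congr_deriv u3
  constructor
  · have b := (((a1.const_mul (2 * f')).const_add k').fun_div (a2.const_mul f')
      (mul_ne_zero hf' v3)).sub_const (2 * c)
    refine (b.congr_deriv (by simp)).congr_of_eventuallyEq ?_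
    filter_upwards [eventually_mem_T hD hz] with s hs
    obtain ⟨-, w1, w2, w3, -, e2, e3⟩ := key _ hs
    have hf := left_ne_zero_of_mul (hfg _ hs)
    simp only at hf e2 e3
    change pdU U (s, x, c) ≠ 0 at w3
    rw [eq_sub_iff_add_eq, div_add' _ _ _ hf, div_eq_div_iff hf (mul_ne_zero hf' w3)]
    refine mul_left_cancel₀ (mul_ne_zero (mul_ne_zero w2 w1) w3) ?_
    linear_combination pdT T (s, x, c) * pdU U (s, x, c) ^ 2 * f' * e3
      - pdT T (s, x, c) * (k' + 2 * f' * U (s, x, c)) * pdU U (s, x, c) * e2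
  · have b := (hasDerivAt_const t g').fun_div
      (((a3.fun_pow 2).fun_mul (a2.fun_pow 2)).const_mul f')
      (mul_ne_zero hf' (mul_ne_zero (pow_ne_zero 2 v2) (pow_ne_zero 2 v3)))
    refine (b.congr_deriv (by simp)).congr_of_eventuallyEq ?_
    filter_upwards [eventually_mem_T hD hz] with s hs
    obtain ⟨-, w1, w2, w3, e1, e2, -⟩ := key _ hs
    have hf := left_ne_zero_of_mul (hfg _ hs)
    simp only at hf e1 e2
    rw [div_eq_div_iff hf (mul_ne_zero hf' (mul_ne_zero (pow_ne_zero 2 w2) (pow_ne_zero 2 w3)))]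
    refine mul_left_cancel₀ (mul_ne_zero w1 w2) ?_
    linear_combination f' * pdT T (s, x, c) * pdU U (s, x, c) ^ 2 * e1
      - pdT T (s, x, c) * g' * e2

end Necessity

/-! ### Proportional coefficients and the conditions on the ratios -/

theorem exists_eq_const_mul {I : Set ℝ} (hI : IsOpen I) (hI' : I.OrdConnected) {φ ψ : ℝ → ℝ}
    (hψ : ∀ t ∈ I, ψ t ≠ 0) (h : ∀ t ∈ I, HasDerivAt (fun s => φ s / ψ s) 0 t) :
    ∃ c : ℝ, ∀ t ∈ I, φ t = c * ψ t := by
  obtain ⟨c, hc⟩ := hI.exists_is_const_of_deriv_eq_zero hI'.isPreconnected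
    (fun t ht => (h t ht).differentiableAt.differentiableWithinAt) (fun t ht => (h t ht).deriv)
  exact ⟨c, fun t ht => (div_eq_iff (hψ t ht)).1 (hc t ht)⟩

theorem deriv_div_eq_zero_of_proportional {I : Set ℝ} (hI : IsOpen I) {φ ψ : ℝ → ℝ} {c : ℝ}
    (hψ : ∀ t ∈ I, ψ t ≠ 0) (h : ∀ t ∈ I, φ t = c * ψ t) {t : ℝ} (ht : t ∈ I) :
    deriv (fun s => φ s / ψ s) t = 0 := by
  have : (fun s => φ s / ψ s) =ᶠ[𝓝 t] fun _ => c := by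
    filter_upwards [hI.mem_nhds ht] with s hs
    rw [h s hs, mul_div_cancel_right₀ _ (hψ s hs)]
  rw [this.deriv_eq, deriv_const]

theorem hasDerivAt_div_of_deriv_eq_zero {I : Set ℝ} (hI : IsOpen I) {φ ψ : ℝ → ℝ}
    (hφ : ContDiffOn ℝ ∞ φ I) (hψ : ContDiffOn ℝ ∞ ψ I) (hψ0 : ∀ t ∈ I, ψ t ≠ 0)
    {t : ℝ} (ht : t ∈ I) (h : deriv (fun s => φ s / ψ s) t = 0) :
    HasDerivAt (fun s => φ s / ψ s) 0 t := by
  have hd : DifferentiableAt ℝ (fun s => φ s / ψ s) t :=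
    (((hφ.div hψ hψ0).contDiffAt (hI.mem_nhds ht)).differentiableAt (by simp))
  rw [← h]
  exact hd.hasDerivAt

/-- A Gardner equation is reducible to constant coefficients if and only if its coefficients are
proportional to each other. -/
theorem reducibleToConstant_iff_proportional {I : Set ℝ} (hI : IsOpen I) (hI' : I.OrdConnected)
    {k f g : ℝ → ℝ} (hc : IsGardnerOn I k f g) {D : Set (ℝ × ℝ × ℝ)} (hD : IsOpen D)
    (hDI : Prod.fst '' D = I) :
    ReducibleToConstant D k f g ↔ ∃ c d : ℝ, ∀ t ∈ I, k t = c * f t ∧ g t = d * f t := by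
  have hmem : ∀ z ∈ D, z.1 ∈ I := fun z hz => hDI ▸ mem_image_of_mem _ hz
  constructor
  · intro h
    have hf0 : ∀ t ∈ I, f t ≠ 0 := fun t ht => left_ne_zero_of_mul (hc.fg_ne_zero t ht)
    have hder : ∀ t ∈ I,
        HasDerivAt (fun s => k s / f s) 0 t ∧ HasDerivAt (fun s => g s / f s) 0 t := by
      rintro t ht
      -- As $D$ projects onto $I$, every time is reached by a point of $D$.
      rw [← hDI] at ht
      obtain ⟨z, hz, rfl⟩ := ht
      exact h.hasDerivAt_div (fun z hz => hc.fg_ne_zero _ (hmem z hz)) hz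
    obtain ⟨c, hck⟩ := exists_eq_const_mul hI hI' hf0 fun t ht => (hder t ht).1
    obtain ⟨d, hdg⟩ := exists_eq_const_mul hI hI' hf0 fun t ht => (hder t ht).2
    exact ⟨c, d, fun t ht => ⟨hck t ht, hdg t ht⟩⟩
  · rintro ⟨c, d, h⟩
    -- Over an empty interval `d` might be zero, so it is replaced by 1; otherwise $g\ne0$ forces
    -- $d\ne0$.
    rcases I.eq_empty_or_nonempty with rfl | ⟨t, ht⟩
    · exact reducible_of_proportional hI hI' hc hD hmem (c := 0) one_ne_zero (by simp) (by simp)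
    · have hd : d ≠ 0 := by
        rintro rfl
        apply hc.fg_ne_zero t ht
        rw [(h t ht).2, zero_mul, mul_zero]
      exact reducible_of_proportional hI hI' hc hD hmem hd (fun t ht => (h t ht).1)
        (fun t ht => (h t ht).2)

theorem proposition2 (I : Set ℝ) (hI_open : IsOpen I) (hI_interval : I.OrdConnected)
    (k f g : ℝ → ℝ) (hclass : IsGardnerOn I k f g)
    (D : Set (ℝ × ℝ × ℝ)) (hD_open : IsOpen D) (hD_proj : Prod.fst '' D = I) :
    ((∀ t ∈ I, k t ≠ 0) →
      (ReducibleToConstant D k f g ↔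
        ∀ t ∈ I, deriv (fun s => f s / k s) t = 0 ∧ deriv (fun s => g s / k s) t = 0)) ∧
    ((∃ t ∈ I, k t = 0) →
      (ReducibleToConstant D k f g ↔
        (∀ t ∈ I, k t = 0) ∧ ∀ t ∈ I, deriv (fun s => g s / f s) t = 0)) := by
  have hf0 : ∀ t ∈ I, f t ≠ 0 := fun t ht => left_ne_zero_of_mul (hclass.fg_ne_zero t ht)
  rw [reducibleToConstant_iff_proportional hI_open hI_interval hclass hD_open hD_proj]
  refine ⟨fun hk => ⟨?_, fun h => ?_⟩, fun hk => ⟨?_, fun h => ?_⟩⟩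
  · rintro ⟨c, d, h⟩ t ht
    have hc : c ≠ 0 := by
      rintro rfl
      exact hk t ht (by rw [(h t ht).1, zero_mul])
    refine ⟨deriv_div_eq_zero_of_proportional (c := 1 / c) hI_open hk (fun s hs => ?_) ht,
      deriv_div_eq_zero_of_proportional (c := d / c) hI_open hk (fun s hs => ?_) ht⟩
    · rw [(h s hs).1]
      field_simp
    · rw [(h s hs).1, (h s hs).2]
      field_simp
  · obtain ⟨c, hcf⟩ := exists_eq_const_mul hI_open hI_interval hk fun t ht =>
      hasDerivAt_div_of_deriv_eq_zero hI_open hclass.smooth_f hclass.smooth_k hk ht (h t ht).1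
    obtain ⟨d, hdg⟩ := exists_eq_const_mul hI_open hI_interval hk fun t ht =>
      hasDerivAt_div_of_deriv_eq_zero hI_open hclass.smooth_g hclass.smooth_k hk ht (h t ht).2
    -- From $f=ck$ and $g=dk$ follow $k=f/c$ and $g=(d/c)f$.
    refine ⟨1 / c, d / c, fun t ht => ?_⟩
    have hc : c ≠ 0 := by
      rintro rfl
      exact hf0 t ht (by rw [hcf t ht, zero_mul])
    rw [hcf t ht, hdg t ht]
    constructor <;> field_simp
  · obtain ⟨t₀, ht₀, hk₀⟩ := hk
    rintro ⟨c, d, h⟩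
    -- Since $k=cf$ with $f$ nowhere zero, a single zero of $k$ makes $k$ vanish identically.
    have hc : c = 0 := by
      have := (h t₀ ht₀).1
      rw [hk₀] at this
      exact (mul_eq_zero.1 this.symm).resolve_right (hf0 t₀ ht₀)
    exact ⟨fun t ht => by rw [(h t ht).1, hc, zero_mul], fun t ht =>
      deriv_div_eq_zero_of_proportional hI_open hf0 (fun s hs => (h s hs).2) ht⟩
  · obtain ⟨d, hdg⟩ := exists_eq_const_mul hI_open hI_interval hf0 fun t ht =>
      hasDerivAt_div_of_deriv_eq_zero hI_open hclass.smooth_g hclass.smooth_f hf0 ht (h.2 t ht)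
    exact ⟨0, d, fun t ht => ⟨by rw [h.1 t ht, zero_mul], hdg t ht⟩⟩
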